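/- **Setting.** Let $n,m$ be integers with $0\le m\le n$. Let $BC_n$ be the Banach space of bounded continuous maps $u:[0,1]\times\mathbb R\to\mathbb R^n$ with norm $\|u\|_\infty=\max_{j}\sup_{x,t}|u_j(x,t)|$, let $BC_n^1$ be the space of all $u\in BC_n$ with $\partial_xu,\partial_tu\in BC_n$, normed by $\|u\|_\infty+\|\partial_xu\|_\infty+\|\partial_tu\|_\infty$, and let $BC_n(\mathbb R)$, $BC_n^1(\mathbb R)$ be the analogous spaces of maps $\mathbb R\to\mathbb R^n$; write $BC^1=BC^1_1$. Consider $$\partial_tu_j+a_j(x,t)\,\partial_xu_j+\sum_{k=1}^n b_{jk}(x,t)\,u_k=f_j(x,t),\qquad (x,t)\in(0,1)\times\mathbb R,\ j\le n, \tag{1}$$ $$u_j(0,t)=(Ru)_j(t)\ \ (1\le j\le m),\qquad u_j(1,t)=(Ru)_j(t)\ \ (m<j\le n),\qquad t\in\mathbb R, \tag{2}$$ where $R:BC_n\to BC_n(\mathbb R)$ is a bounded linear operator. Assume: * $a_j,b_{jk}\in BC^1$ for all $j,k\le n$; $\inf_{j\le m,\,x,t}a_j>0$ and $\sup_{j>m,\,x,t}a_j<0$;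 * the restriction of $R$ to $BC_n^1$ is a bounded linear operator from $BC^1_n$ to $BC^1_n(\mathbb R)$; * for all $j\ne k$ there is $\tilde b_{jk}\in BC^1$ with $b_{jk}=\tilde b_{jk}(a_k-a_j)$; * for every $\varepsilon>0$ there is a compact interval $I\subset\mathbb R$ such that $|b_{jk}(x,t)|<\varepsilon$ for all $j\ne k$, $x\in[0,1]$, $t\in\mathbb R\setminus I$. For $j\le n$, $x\in[0,1]$, $t\in\mathbb R$ let $\xi\in[0,1]\mapsto\omega_j(\xi)=\omega_j(\xi,x,t)$ be the solution of $\partial_\xi\omega_j(\xi)=1/a_j(\xi,\omega_j(\xi))$, $\omega_j(x)=t$, and put $$c_j(\xi,x,t)=\exp\int_x^\xi\Big(\frac{b_{jj}}{a_j}\Big)(\eta,\omega_j(\eta))\,d\eta,\qquad d_j(\xi,x,t)=\frac{c_j(\xi,x,t)}{a_j(\xi,\omega_j(\xi))},$$ with $x_j=0$ for $j\le m$ and $x_j=1$ for $j>m$. Let $C:BC_n\to BC_n$ be the bounded linear operator $(Cv)_j(x,t)=c_j(x_j,x,t)\,(Rv)_j(\omega_j(x_j))$, and assume finally that $\|C^\ell\|_{\mathcal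 L(BC_n)}<1$ for some $\ell\in\mathbb N$. For $f\in BC_n$, a *bounded continuous solution* to (1)–(2) is a function $u\in BC_n$ such that for all $j\le n$, $x\in[0,1]$, $t\in\mathbb R$ $$u_j(x,t)=c_j(x_j,x,t)(Ru)_j(\omega_j(x_j))-\int_{x_j}^x d_j(\xi,x,t)\sum_{k\ne j}b_{jk}(\xi,\omega_j(\xi))\,u_k(\xi,\omega_j(\xi))\,d\xi+\int_{x_j}^x d_j(\xi,x,t)f_j(\xi,\omega_j(\xi))\,d\xi .$$ **Theorem.** Let $\mathcal K$ be the vector space of all bounded continuous solutions to (1)–(2) with $f\equiv0$. Then: (i) $\dim\mathcal K<\infty$, and the set of all $f\in BC_n$ for which there exists a bounded continuous solution to (1)–(2) is a closed linear subspace of $BC_n$ of codimension $\dim\mathcal K$. (ii) If $\dim\mathcal K=0$, then for every $f\in BC_n$ there exists a unique bounded continuous solution to (1)–(2). -/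

import Mathlib

open Set
open scoped BoundedContinuousFunction

namespace HypStrip

/-- The strip `[0,1] × ℝ`. -/
abbrev Strip : Type := unitInterval × ℝ

/-- Bounded continuous maps `[0,1] × ℝ → E` with the supremum norm. -/
abbrev BC (E : Type) [NormedAddCommGroup E] : Type := Strip →ᵇ E

/-- `BC_n`: here `Fin n → ℝ` carries the maximum norm. -/
abbrev BCn (n : ℕ) : Type := BC (Fin n → ℝ)

/-- `BC_n(ℝ)`. -/
abbrev BCnR (n : ℕ) : Type := ℝ →ᵇ (Fin n → ℝ)

/-- The retraction of `ℝ` onto `[0,1]`; it is only ever evaluated at points of `[0,1]`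
when integrals over subintervals of `[0,1]` and one-sided derivatives are formed. -/
noncomputable def pr (s : ℝ) : unitInterval := Set.projIcc (0 : ℝ) 1 zero_le_one s

/-- `ux` and `ut` are the partial derivatives of `u` on the closed strip
(one-sided in `x` at `x = 0` and `x = 1`). -/
def HasPartials {E : Type} [NormedAddCommGroup E] [NormedSpace ℝ E] (u ux ut : BC E) : Prop :=
  (∀ (x : unitInterval) (t : ℝ),
    HasDerivWithinAt (fun y : ℝ => u (pr y, t)) (ux (x, t)) (Icc 0 1) (x : ℝ)) ∧
  (∀ (x : unitInterval) (t : ℝ), HasDerivAt (fun s : ℝ => u (x, s)) (ut (x, t)) t)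

/-- Membership in `BC^1`: both partial derivatives exist and are bounded and continuous. -/
def IsBC1 {E : Type} [NormedAddCommGroup E] [NormedSpace ℝ E] (u : BC E) : Prop :=
  ∃ ux ut : BC E, HasPartials u ux ut

/-- `w` solves `w' (ξ) = 1 / α (ξ, w ξ)` on `[0,1]`, `w x = t`. -/
def IsCharacteristic (α : BC ℝ) (x : unitInterval) (t : ℝ) (w : unitInterval → ℝ) : Prop :=
  w x = t ∧ ∀ ξ : unitInterval,
    HasDerivWithinAt (fun s : ℝ => w (pr s)) (1 / α (ξ, w ξ)) (Icc 0 1) (ξ : ℝ)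

/-- The characteristic `ω (ξ, x, t)` of the speed `α`: the solution of the initial value problem
(it exists and is unique for the speeds considered here, see below). -/
noncomputable def omega (α : BC ℝ) (ξ x : unitInterval) (t : ℝ) : ℝ :=
  Classical.epsilon (IsCharacteristic α x t) ξ

/-- `c (ξ, x, t) = exp ∫_x^ξ (β / α) (η, ω (η, x, t)) dη`. -/
noncomputable def cCoef (α β : BC ℝ) (ξ x : unitInterval) (t : ℝ) : ℝ :=
  Real.exp (∫ η in (x : ℝ)..(ξ : ℝ),
    β (pr η, omega α (pr η) x t) / α (pr η, omega α (pr η) x t))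

/-- `d (ξ, x, t) = c (ξ, x, t) / α (ξ, ω (ξ, x, t))`. -/
noncomputable def dCoef (α β : BC ℝ) (ξ x : unitInterval) (t : ℝ) : ℝ :=
  cCoef α β ξ x t / α (ξ, omega α ξ x t)

/-! ### Existence, uniqueness and continuity of the characteristics -/

theorem pr_of_mem {s : ℝ} (hs : s ∈ Icc (0 : ℝ) 1) : pr s = ⟨s, hs⟩ :=
  Set.projIcc_of_mem zero_le_one hs

@[simp] theorem pr_coe (x : unitInterval) : pr (x : ℝ) = x :=
  Set.projIcc_val zero_le_one x

theorem continuous_pr : Continuous pr := continuous_projIcc (h := zero_le_one)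

theorem ode_stability {v : ℝ → ℝ → ℝ} {K : ℝ}
    (hv : ∀ s y z, |v s y - v s z| ≤ K * |y - z|) {f g : ℝ → ℝ}
    (hf : ∀ s ∈ Icc (0 : ℝ) 1, HasDerivWithinAt f (v s (f s)) (Icc 0 1) s)
    (hg : ∀ s ∈ Icc (0 : ℝ) 1, HasDerivWithinAt g (v s (g s)) (Icc 0 1) s)
    {r s : ℝ} (hr : r ∈ Icc (0 : ℝ) 1) (hs : s ∈ Icc (0 : ℝ) 1) :
    |f s - g s| ≤ Real.exp K * |f r - g r| := by
  have hK : 0 ≤ K := by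
    have := hv 0 0 1
    have h2 := abs_nonneg (v 0 0 - v 0 1)
    norm_num at this
    linarith
  have key : ∀ y z s, |2 * ((y - z) * (v s y - v s z))| ≤ 2 * K * (y - z) ^ 2 := by
    intro y z s
    rw [abs_mul, abs_mul, abs_two, ← sq_abs (y - z)]
    nlinarith [hv s y z, abs_nonneg (y - z), mul_le_mul_of_nonneg_left (hv s y z) (abs_nonneg (y - z))]
  have hder : ∀ c : ℝ, ∀ s ∈ Icc (0 : ℝ) 1,
      HasDerivWithinAt (fun s => Real.exp (c * s) * (f s - g s) ^ 2)
        (Real.exp (c * s) * (c * (f s - g s) ^ 2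
          + 2 * ((f s - g s) * (v s (f s) - v s (g s))))) (Icc 0 1) s := by
    intro c s hs
    have h1 : HasDerivWithinAt (fun s : ℝ => Real.exp (c * s)) (Real.exp (c * s) * c) (Icc 0 1) s := by
      have := ((hasDerivAt_id s).const_mul c).exp.hasDerivWithinAt (s := Icc 0 1)
      simpa using this
    have h2 := ((hf s hs).sub (hg s hs)).pow 2
    refine (h1.mul h2).congr_deriv ?_
    simp
    ring
  have hcont : ∀ c : ℝ, ContinuousOn (fun s => Real.exp (c * s) * (f s - g s) ^ 2) (Icc (0 : ℝ) 1) :=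
    fun c s hs => (hder c s hs).continuousWithinAt
  have hmono : MonotoneOn (fun s => Real.exp (2 * K * s) * (f s - g s) ^ 2) (Icc (0 : ℝ) 1) := by
    refine monotoneOn_of_hasDerivWithinAt_nonneg (convex_Icc 0 1) (hcont _)
      (fun s hs => (hder (2 * K) s (interior_subset hs)).mono interior_subset) ?_
    intro s _
    have := (abs_le.1 (key (f s) (g s) s)).1
    exact mul_nonneg (Real.exp_pos _).le (by linarith)
  have hanti : AntitoneOn (fun s => Real.exp (-(2 * K) * s) * (f s - g s) ^ 2) (Icc (0 : ℝ) 1) := by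
    refine antitoneOn_of_hasDerivWithinAt_nonpos (convex_Icc 0 1) (hcont _)
      (fun s hs => (hder (-(2 * K)) s (interior_subset hs)).mono interior_subset) ?_
    intro s _
    have := (abs_le.1 (key (f s) (g s) s)).2
    exact mul_nonpos_of_nonneg_of_nonpos (Real.exp_pos _).le (by linarith)
  have hsq : (f s - g s) ^ 2 ≤ Real.exp (2 * K) * (f r - g r) ^ 2 := by
    have e : ∀ c : ℝ, Real.exp (c * s) * (f s - g s) ^ 2 ≤ Real.exp (c * r) * (f r - g r) ^ 2 →
        c * r - c * s ≤ 2 * K → (f s - g s) ^ 2 ≤ Real.exp (2 * K) * (f r - g r) ^ 2 := by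
      intro c h1 h2
      have h3 : (f s - g s) ^ 2 ≤ Real.exp (c * r - c * s) * (f r - g r) ^ 2 := by
        rw [Real.exp_sub, div_mul_eq_mul_div, le_div_iff₀ (Real.exp_pos _)]
        linarith
      exact h3.trans (mul_le_mul_of_nonneg_right (Real.exp_le_exp.2 h2) (sq_nonneg _))
    rcases le_total r s with h | h
    · exact e _ (hanti hr hs h) (by nlinarith [hr.1, hs.2])
    · exact e _ (hmono hs hr h) (by nlinarith [hs.1, hr.2])
  refine abs_le_of_sq_le_sq' ?_ (by positivity) |> abs_le.2
  rw [mul_pow, sq_abs, ← Real.exp_nat_mul]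
  simpa using hsq

theorem inv_speed_lipschitz {α : BC ℝ} (hα : IsBC1 α) {c : ℝ} (hc : 0 < c)
    (hle : ∀ p, c ≤ |α p|) :
    ∃ K : ℝ, ∀ (x : unitInterval) (y z : ℝ), |1 / α (x, y) - 1 / α (x, z)| ≤ K * |y - z| := by
  obtain ⟨_, αt, _, ht⟩ := hα
  refine ⟨‖αt‖ / c ^ 2, fun x y z => ?_⟩
  have hne : ∀ p, α p ≠ 0 := fun p h => by
    have := hle p
    rw [h, abs_zero] at this
    linarith
  have hlip : |α (x, z) - α (x, y)| ≤ ‖αt‖ * |z - y| := by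
    have := (convex_univ (𝕜 := ℝ) (E := ℝ)).norm_image_sub_le_of_norm_hasDerivWithin_le
      (f := fun s => α (x, s)) (f' := fun s => αt (x, s)) (C := ‖αt‖)
      (fun s _ => (ht x s).hasDerivWithinAt) (fun s _ => αt.norm_coe_le_norm _)
      (mem_univ y) (mem_univ z)
    simpa using this
  rw [div_sub_div _ _ (hne _) (hne _), abs_div, abs_mul, one_mul, mul_one,
    div_mul_eq_mul_div, abs_sub_comm y z]
  have h1 : c ^ 2 ≤ |α (x, y)| * |α (x, z)| := by
    rw [sq]
    exact mul_le_mul (hle _) (hle _) hc.le (abs_nonneg _)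
  exact div_le_div₀ (by positivity) hlip (by positivity) h1

theorem isCharacteristic_existsUnique {α : BC ℝ} (hα : IsBC1 α) {c : ℝ} (hc : 0 < c)
    (hle : ∀ p, c ≤ |α p|) (x : unitInterval) (t : ℝ) :
    ∃! w : unitInterval → ℝ, IsCharacteristic α x t w := by
  obtain ⟨K, hK⟩ := inv_speed_lipschitz hα hc hle
  have hne : ∀ p, α p ≠ 0 := fun p h => by
    have := hle p
    rw [h, abs_zero] at this
    linarith
  refine existsUnique_of_exists_of_unique ?_ ?_
  · let L : NNReal := ⟨1 / c, by positivity⟩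
    have hK' : 0 ≤ K := by
      have := (abs_nonneg _).trans (hK 0 0 1)
      norm_num at this
      exact this
    have hPL : IsPicardLindelof (fun s y => 1 / α (pr s, y)) (tmin := 0) (tmax := 1) x t L 0 L
        ⟨K, hK'⟩ := by
      refine ⟨fun s _ => ?_, fun y _ => ?_, fun s _ y _ => ?_, ?_⟩
      · refine (LipschitzWith.of_dist_le_mul fun y z => ?_).lipschitzOnWith
        exact hK (pr s) y z
      · refine Continuous.continuousOn ?_
        refine continuous_const.div ?_ fun s => hne _
        exact α.continuous.comp (continuous_pr.prodMk continuous_const)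
      · rw [Real.norm_eq_abs, abs_div, abs_one]
        exact one_div_le_one_div_of_le hc (hle _)
      · have h1 : max (1 - (x : ℝ)) ((x : ℝ) - 0) ≤ 1 :=
          max_le (by linarith [x.2.1]) (by linarith [x.2.2])
        have := mul_le_mul_of_nonneg_left h1 L.2
        simpa using this
    obtain ⟨f, hf0, hf⟩ := hPL.exists_eq_forall_mem_Icc_hasDerivWithinAt₀
    refine ⟨fun ξ => f ξ, hf0, fun ξ => ?_⟩
    have h := hf ξ ξ.2
    rw [pr_coe] at h
    refine h.congr (fun s hs => ?_) ?_
    · rw [pr_of_mem hs]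
    · rw [pr_coe]
  · intro w₁ w₂ h₁ h₂
    have hd : ∀ w, IsCharacteristic α x t w → ∀ s ∈ Icc (0 : ℝ) 1,
        HasDerivWithinAt (fun s => w (pr s)) (1 / α (pr s, w (pr s))) (Icc 0 1) s := by
      intro w hw s hs
      have := hw.2 ⟨s, hs⟩
      simpa only [pr_of_mem hs] using this
    funext ξ
    have := ode_stability (v := fun s y => 1 / α (pr s, y)) (fun s => hK (pr s))
      (hd w₁ h₁) (hd w₂ h₂) x.2 ξ.2
    simp only [pr_coe, h₁.1, h₂.1, sub_self, abs_zero, mul_zero] at this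
    exact sub_eq_zero.1 (abs_nonpos_iff.1 this)

theorem omega_spec {α : BC ℝ} (hα : IsBC1 α) {c : ℝ} (hc : 0 < c)
    (hle : ∀ p, c ≤ |α p|) (x : unitInterval) (t : ℝ) :
    IsCharacteristic α x t (fun ξ => omega α ξ x t) :=
  Classical.epsilon_spec (isCharacteristic_existsUnique hα hc hle x t).exists

theorem continuous_omega {α : BC ℝ} (hα : IsBC1 α) {c : ℝ} (hc : 0 < c)
    (hle : ∀ p, c ≤ |α p|) :
    Continuous fun q : unitInterval × Strip => omega α q.1 q.2.1 q.2.2 := by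
  obtain ⟨K, hK⟩ := inv_speed_lipschitz hα hc hle
  have hd : ∀ (x : unitInterval) (t : ℝ), ∀ s ∈ Icc (0 : ℝ) 1,
      HasDerivWithinAt (fun s => omega α (pr s) x t) (1 / α (pr s, omega α (pr s) x t))
        (Icc 0 1) s := by
    intro x t s hs
    have := (omega_spec hα hc hle x t).2 ⟨s, hs⟩
    simpa only [pr_of_mem hs] using this
  have h0 : ∀ (x : unitInterval) (t : ℝ), omega α x x t = t :=
    fun x t => (omega_spec hα hc hle x t).1
  have hsp : ∀ (ξ ξ' x : unitInterval) (t : ℝ),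
      |omega α ξ x t - omega α ξ' x t| ≤ 1 / c * |(ξ : ℝ) - ξ'| := by
    intro ξ ξ' x t
    have := (convex_Icc (0 : ℝ) 1).norm_image_sub_le_of_norm_hasDerivWithin_le
      (C := 1 / c) (hd x t) (fun s _ => by
        rw [Real.norm_eq_abs, abs_div, abs_one]
        exact one_div_le_one_div_of_le hc (hle _)) ξ'.2 ξ.2
    simpa using this
  have hmain : ∀ q q' : unitInterval × Strip,
      |omega α q.1 q.2.1 q.2.2 - omega α q'.1 q'.2.1 q'.2.2| ≤
        1 / c * |(q.1 : ℝ) - q'.1|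
          + Real.exp K * (1 / c * |(q.2.1 : ℝ) - q'.2.1| + |q.2.2 - q'.2.2|) := by
    rintro ⟨ξ, x, t⟩ ⟨ξ', x', t'⟩
    have h1 := hsp ξ ξ' x t
    have h2 := ode_stability (v := fun s y => 1 / α (pr s, y)) (fun s => hK (pr s))
      (hd x t) (hd x' t') x.2 ξ'.2
    simp only [pr_coe] at h2
    have h3 := hsp x x' x' t'
    rw [h0 x' t'] at h3
    have h4 : |omega α x x t - omega α x x' t'| ≤ 1 / c * |(x : ℝ) - x'| + |t - t'| := by
      rw [h0 x t]
      calc |t - omega α x x' t'| ≤ |t - t'| + |t' - omega α x x' t'| := abs_sub_le _ _ _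
        _ ≤ _ := by rw [abs_sub_comm t']; linarith
    have h5 := mul_le_mul_of_nonneg_left h4 (Real.exp_pos K).le
    exact (abs_sub_le _ (omega α ξ' x t) _).trans (by dsimp only; linarith)
  rw [continuous_iff_continuousAt]
  intro q'
  rw [ContinuousAt, tendsto_iff_dist_tendsto_zero]
  refine squeeze_zero (fun _ => dist_nonneg) (fun q => hmain q q') ?_
  have hcont : Continuous fun q : unitInterval × Strip => 1 / c * |(q.1 : ℝ) - q'.1|
      + Real.exp K * (1 / c * |(q.2.1 : ℝ) - q'.2.1| + |q.2.2 - q'.2.2|) := by fun_prop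
  simpa using hcont.tendsto q'

theorem continuous_cCoef {α : BC ℝ} (hα : IsBC1 α) {c : ℝ} (hc : 0 < c)
    (hle : ∀ p, c ≤ |α p|) (β : BC ℝ) (ξ : unitInterval) :
    Continuous fun p : Strip => cCoef α β ξ p.1 p.2 := by
  refine Real.continuous_exp.comp ?_
  have hne : ∀ p, α p ≠ 0 := fun p h => by
    have := hle p
    rw [h, abs_zero] at this
    linarith
  have hpt : Continuous fun q : Strip × ℝ => ((pr q.2, omega α (pr q.2) q.1.1 q.1.2) : Strip) := by
    have h0 : Continuous fun q : Strip × ℝ => pr q.2 := continuous_pr.comp continuous_snd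
    exact h0.prodMk ((continuous_omega hα hc hle).comp (h0.prodMk continuous_fst))
  have hint : Continuous (Function.uncurry fun (p : Strip) (η : ℝ) =>
      β (pr η, omega α (pr η) p.1 p.2) / α (pr η, omega α (pr η) p.1 p.2)) :=
    (β.continuous.comp hpt).div (α.continuous.comp hpt) fun q => hne _
  have h := (intervalIntegral.continuous_parametric_intervalIntegral_of_continuous
    (μ := MeasureTheory.volume) (a₀ := (ξ : ℝ)) hint
    (s := fun p : Strip => (p.1 : ℝ)) (by fun_prop)).neg
  refine h.congr fun p => ?_
  exact (intervalIntegral.integral_symm (E := ℝ) (ξ : ℝ) (p.1 : ℝ)).symm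

theorem abs_cCoef_le {α : BC ℝ} {c : ℝ} (hc : 0 < c)
    (hle : ∀ p, c ≤ |α p|) (β : BC ℝ) (ξ x : unitInterval) (t : ℝ) :
    |cCoef α β ξ x t| ≤ Real.exp (‖β‖ / c) := by
  rw [cCoef, Real.abs_exp, Real.exp_le_exp]
  refine (le_abs_self _).trans ?_
  have h := intervalIntegral.norm_integral_le_of_norm_le_const (E := ℝ) (a := (x : ℝ)) (b := (ξ : ℝ))
    (C := ‖β‖ / c)
    (f := fun η => β (pr η, omega α (pr η) x t) / α (pr η, omega α (pr η) x t))
    (fun η _ => by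
      rw [norm_div]
      exact div_le_div₀ (norm_nonneg _) (β.norm_coe_le_norm _) hc (hle _))
  refine h.trans (mul_le_of_le_one_right (by positivity) ?_)
  exact abs_le.2 ⟨by linarith [x.2.2, ξ.2.1], by linarith [x.2.1, ξ.2.2]⟩

/-! ### The boundary value problem -/

/-- The data of the boundary value problem
`∂_t u_j + a_j ∂_x u_j + ∑_k b_jk u_k = f_j` on `(0,1) × ℝ`,
`u_j(0,t) = (Ru)_j(t)` for the first `m` indices, `u_j(1,t) = (Ru)_j(t)` for the others:
coefficients in `BC^1`, the first `m` speeds are bounded below by a positive constant, the others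
bounded above by a negative one, and `R` is a bounded linear operator
from `BC_n` to `BC_n(ℝ)`. -/
structure HyperbolicProblem (n : ℕ) where
  m : ℕ
  m_le : m ≤ n
  a : Fin n → BC ℝ
  b : Fin n → Fin n → BC ℝ
  R : BCn n →L[ℝ] BCnR n
  a_bc1 : ∀ j, IsBC1 (a j)
  b_bc1 : ∀ j k, IsBC1 (b j k)
  a_pos : ∃ δ : ℝ, 0 < δ ∧ ∀ j : Fin n, (j : ℕ) < m → ∀ p, δ ≤ a j p
  a_neg : ∃ δ : ℝ, 0 < δ ∧ ∀ j : Fin n, m ≤ (j : ℕ) → ∀ p, a j p ≤ -δ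

namespace HyperbolicProblem

variable {n : ℕ} (S : HyperbolicProblem n)

/-- The endpoint `x_j` where the `j`-th boundary condition is posed. -/
noncomputable def entry (j : Fin n) : unitInterval := if (j : ℕ) < S.m then 0 else 1

/-- The `j`-th characteristic `ω_j(ξ, x, t)`. -/
noncomputable def ω (j : Fin n) (ξ x : unitInterval) (t : ℝ) : ℝ := omega (S.a j) ξ x t

/-- `c_j(ξ, x, t)`. -/
noncomputable def c (j : Fin n) (ξ x : unitInterval) (t : ℝ) : ℝ := cCoef (S.a j) (S.b j j) ξ x t

/-- `d_j(ξ, x, t)`. -/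
noncomputable def d (j : Fin n) (ξ x : unitInterval) (t : ℝ) : ℝ := dCoef (S.a j) (S.b j j) ξ x t

/-- `u` is a bounded continuous solution with right-hand side `f`: it satisfies
the system of integral equations obtained by integration along the characteristics. -/
def IsBCSolution (f u : BCn n) : Prop :=
  ∀ (j : Fin n) (x : unitInterval) (t : ℝ),
    u (x, t) j = S.c j (S.entry j) x t * S.R u (S.ω j (S.entry j) x t) j
      - (∫ ξ in (S.entry j : ℝ)..(x : ℝ), S.d j (pr ξ) x t *
          ∑ k ∈ Finset.univ.erase j,
            S.b j k (pr ξ, S.ω j (pr ξ) x t) * u (pr ξ, S.ω j (pr ξ) x t) k)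
      + ∫ ξ in (S.entry j : ℝ)..(x : ℝ), S.d j (pr ξ) x t * f (pr ξ, S.ω j (pr ξ) x t) j

/-- The restriction of `R` to `BC_n^1` is a bounded linear operator from `BC_n^1` to
`BC_n^1(ℝ)`, for the `C^1` norms. -/
def BoundaryRegular : Prop :=
  ∃ M : ℝ, ∀ u ux ut : BCn n, HasPartials u ux ut →
    ∃ v' : BCnR n, (∀ t : ℝ, HasDerivAt (fun s => S.R u s) (v' t) t) ∧
      ‖S.R u‖ + ‖v'‖ ≤ M * (‖u‖ + ‖ux‖ + ‖ut‖)

/-- For `j ≠ k` there is `b̃_jk` in `BC^1` with `b_jk = b̃_jk (a_k - a_j)`. -/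
def Factorizes : Prop :=
  ∀ j k : Fin n, j ≠ k → ∃ bt : BC ℝ, IsBC1 bt ∧ ∀ p, S.b j k p = bt p * (S.a k p - S.a j p)

/-- The off-diagonal coefficients vanish at infinity. -/
def OffDiagonalVanishes : Prop :=
  ∀ ε : ℝ, 0 < ε → ∃ T₁ T₂ : ℝ, ∀ j k : Fin n, j ≠ k →
    ∀ (x : unitInterval) (t : ℝ), t ∉ Icc T₁ T₂ → |S.b j k (x, t)| < ε

theorem exists_speed_bound : ∃ δ : ℝ, 0 < δ ∧ ∀ (j : Fin n) (p : Strip), δ ≤ |S.a j p| := by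
  obtain ⟨δ₁, h₁, hp⟩ := S.a_pos
  obtain ⟨δ₂, h₂, hn⟩ := S.a_neg
  refine ⟨min δ₁ δ₂, lt_min h₁ h₂, fun j p => ?_⟩
  rcases lt_or_ge (j : ℕ) S.m with h | h
  · exact (min_le_left _ _).trans ((hp j h p).trans (le_abs_self _))
  · exact (min_le_right _ _).trans ((le_neg.1 (hn j h p)).trans (neg_le_abs _))

theorem continuous_boundary_term (v : BCn n) :
    Continuous fun p : Strip => fun j : Fin n =>
      S.c j (S.entry j) p.1 p.2 * S.R v (S.ω j (S.entry j) p.1 p.2) j := by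
  obtain ⟨δ, hδ, hle⟩ := S.exists_speed_bound
  refine continuous_pi fun j => ?_
  refine (continuous_cCoef (S.a_bc1 j) hδ (hle j) (S.b j j) (S.entry j)).mul ?_
  have h1 : Continuous fun p : Strip => S.ω j (S.entry j) p.1 p.2 :=
    (continuous_omega (S.a_bc1 j) hδ (hle j)).comp (continuous_const.prodMk continuous_id)
  exact (continuous_apply j).comp ((S.R v).continuous.comp h1)

theorem exists_boundary_bound : ∃ M : ℝ, ∀ (v : BCn n) (p : Strip),
    ‖(fun j : Fin n => S.c j (S.entry j) p.1 p.2 * S.R v (S.ω j (S.entry j) p.1 p.2) j)‖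
      ≤ M * ‖v‖ := by
  obtain ⟨δ, hδ, hle⟩ := S.exists_speed_bound
  refine ⟨(∑ j, Real.exp (‖S.b j j‖ / δ)) * ‖S.R‖, fun v p => ?_⟩
  refine (pi_norm_le_iff_of_nonneg (by positivity)).2 fun j => ?_
  rw [norm_mul, mul_assoc]
  refine mul_le_mul ?_ ?_ (norm_nonneg _) (by positivity)
  · exact (abs_cCoef_le hδ (hle j) _ _ _ _).trans
      (Finset.single_le_sum (f := fun j => Real.exp (‖S.b j j‖ / δ))
        (fun _ _ => (Real.exp_pos _).le) (Finset.mem_univ j))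
  · exact (norm_le_pi_norm _ j).trans (((S.R v).norm_coe_le_norm _).trans (S.R.le_opNorm v))

/-- The bounded linear operator `C : BC_n → BC_n`,
`(Cv)_j(x,t) = c_j(x_j,x,t) (Rv)_j(ω_j(x_j,x,t))`. -/
noncomputable def C : BCn n →L[ℝ] BCn n :=
  LinearMap.mkContinuousOfExistsBound
    { toFun := fun v => BoundedContinuousFunction.ofNormedAddCommGroup
        (fun p : Strip => fun j : Fin n =>
          S.c j (S.entry j) p.1 p.2 * S.R v (S.ω j (S.entry j) p.1 p.2) j)
        (S.continuous_boundary_term v) (S.exists_boundary_bound.choose * ‖v‖)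
        (S.exists_boundary_bound.choose_spec v)
      map_add' := fun v w => by
        ext p j
        simp [mul_add]
      map_smul' := fun r v => by
        ext p j
        simp [mul_left_comm] }
    (by
      obtain ⟨M, hM⟩ := S.exists_boundary_bound
      refine ⟨|M|, fun v => ?_⟩
      refine (BoundedContinuousFunction.norm_le (by positivity)).2 fun p => ?_
      exact (hM v p).trans (mul_le_mul_of_nonneg_right (le_abs_self M) (norm_nonneg v)))

theorem C_apply (v : BCn n) (x : unitInterval) (t : ℝ) (j : Fin n) :
    S.C v (x, t) j = S.c j (S.entry j) x t * S.R v (S.ω j (S.entry j) x t) j := rfl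

end HyperbolicProblem

end HypStrip

/-!
The integral equations of the boundary value problem read `u = C u + F (B u + f)`, where `B` is
multiplication by the off-diagonal part of `-b` and `F` is integration along the characteristics.
Since `‖C ^ ℓ‖ < 1`, the operator `1 - C` has an inverse `W`, and with `A = W F` the problem becomes
`u = A (B u + f)`, or `w - B A w = f` for `w = B u + f`. So solutions exist exactly for `f` in the
range of `1 - B A`, and `u ↦ B u` identifies the homogeneous solutions with the kernel of `1 - B A`.
The theorem says that `1 - B A` is a Fredholm operator of index zero, which holds because
`(B A)²` is compact (`SquareCompact.fredholm_index_zero`).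

As `W = 1 + C W`, it suffices that `F B C` and `F B F` are compact
(`isCompactOperator_F_B_C`, `isCompactOperator_F_B_F`). Both consist of integrals, along a
characteristic of the `j`-th equation, of `b_jk` times a function that is transported along the
characteristics of the `k`-th equation, `k ≠ j`. The value `z (ξ)` on which that function depends
satisfies `z' (ξ) = e (1 / a_j - 1 / a_k)` with a positive continuous factor `e`
(`hasDerivWithinAt_omega_comp`), and by hypothesis `b_jk` contains the factor `a_k - a_j`. Hence the
integrals have the form `∫ E h (z) z' dξ` with `E` continuous, and they depend on the base point in
an equicontinuous way as `h` runs through the bounded continuous functions with `‖h‖ ≤ 1`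
(`ballEquicontAt_integral`, `ballEquicontAt_transport`). The decay of `b_jk` as `|t| → ∞` replaces
the missing compactness of the strip, and the Arzelà–Ascoli theorem applies
(`isCompactOperator_of_ballEquicontAt`).
-/

/-! ### Fredholm alternative for operators with compact square -/

namespace SquareCompact

open Filter Topology

variable {X : Type*} [NormedAddCommGroup X] [NormedSpace ℝ X]

/-- If `S²` is compact and `1 - S` is injective, then `1 - S` is bounded below: along a sequence of
unit vectors with `(1 - S) xₙ → 0`, also `S² xₙ - xₙ → 0`, so a subsequence of `xₙ` converges. -/
theorem antilipschitz_one_sub {S : X →L[ℝ] X} (hS : IsCompactOperator (S * S : X →L[ℝ] X))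
    (hinj : Function.Injective (1 - S : X →L[ℝ] X)) :
    ∃ K, AntilipschitzWith K (1 - S : X →L[ℝ] X) := by
  rw [antilipschitzWith_iff_exists_mul_le_norm]
  by_contra! h
  have hx : ∀ n : ℕ, ∃ x : X, ‖x‖ = 1 ∧ ‖(1 - S : X →L[ℝ] X) x‖ < 1 / ((n : ℝ) + 1) := by
    intro n
    obtain ⟨x, hx⟩ := h (1 / ((n : ℝ) + 1)) (by positivity)
    have hx0 : x ≠ 0 := by
      rintro rfl
      simp at hx
    have hn : 0 < ‖x‖ := norm_pos_iff.2 hx0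
    refine ⟨‖x‖⁻¹ • x, by rw [norm_smul, norm_inv, norm_norm, inv_mul_cancel₀ hn.ne'], ?_⟩
    rw [map_smul, norm_smul, norm_inv, norm_norm, inv_mul_lt_iff₀ hn, mul_comm]
    exact hx
  choose x hx1 hx2 using hx
  have hU : Tendsto (fun n => (1 - S : X →L[ℝ] X) (x n)) atTop (𝓝 0) :=
    squeeze_zero_norm (fun n => (hx2 n).le) tendsto_one_div_add_atTop_nhds_zero_nat
  obtain ⟨K, hK, hK'⟩ := hS.image_closedBall_subset_compact 1
  obtain ⟨y, -, ψ, hψ, hy⟩ := hK.tendsto_subseq (x := fun n => (S * S : X →L[ℝ] X) (x n))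
    (fun n => hK' ⟨x n, by simp [hx1], rfl⟩)
  have hlim : Tendsto (fun n => x (ψ n)) atTop (𝓝 y) := by
    have h1 : Tendsto (fun n => (1 + S : X →L[ℝ] X) ((1 - S : X →L[ℝ] X) (x (ψ n)))) atTop
        (𝓝 0) := by
      simpa [Function.comp_def] using
        ((1 + S : X →L[ℝ] X).continuous.tendsto 0).comp (hU.comp hψ.tendsto_atTop)
    have h2 := hy.add h1
    rw [add_zero] at h2
    refine h2.congr fun n => ?_
    simp
  have hy1 : ‖y‖ = 1 := by
    refine tendsto_nhds_unique hlim.norm ?_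
    simp [hx1]
  have hy0 : (1 - S : X →L[ℝ] X) y = 0 :=
    tendsto_nhds_unique (((1 - S : X →L[ℝ] X).continuous.tendsto y).comp hlim)
      (hU.comp hψ.tendsto_atTop)
  have : y = 0 := hinj (by rw [hy0, map_zero])
  simp [this] at hy1

variable [CompleteSpace X]

/-- If `S²` is compact and `1 - S` is injective, then `1 - S` is surjective. Otherwise the ranges of
the powers of `U = 1 - S` decrease strictly, and Riesz's lemma yields a bounded sequence
`fₙ ∈ range Uⁿ` at distance at least `1` from `range Uⁿ⁺¹`; since `S² = 1 - U (1 + S)`, the images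
`S² fₙ` are `1`-separated. -/
theorem surjective_of_injective {S : X →L[ℝ] X} (hS : IsCompactOperator (S * S : X →L[ℝ] X))
    (hinj : Function.Injective (1 - S : X →L[ℝ] X)) :
    Function.Surjective (1 - S : X →L[ℝ] X) := by
  by_contra hsurj
  obtain ⟨K, hK⟩ := antilipschitz_one_sub hS hinj
  set U : X →L[ℝ] X := 1 - S with hUdef
  have hemb : Topology.IsClosedEmbedding U := hK.isClosedEmbedding U.uniformContinuous
  let V : ℕ → Submodule ℝ X := fun n => LinearMap.range ((U ^ n : X →L[ℝ] X) : X →ₗ[ℝ] X)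
  have hVmem : ∀ n x, x ∈ V n ↔ ∃ y, (U ^ n) y = x := fun n x => Iff.rfl
  have hVclosed : ∀ n, IsClosed (V n : Set X) := by
    intro n
    have : ∀ n : ℕ, Topology.IsClosedEmbedding (U ^ n : X →L[ℝ] X) := by
      intro n
      induction n with
      | zero => exact Topology.IsClosedEmbedding.id
      | succ n ih =>
        rw [pow_succ]
        exact ih.comp hemb
    exact (this n).isClosed_range
  have hVanti : ∀ m n, m ≤ n → V n ≤ V m := by
    rintro m n hmn x hx
    obtain ⟨y, rfl⟩ := (hVmem _ _).1 hx
    obtain ⟨k, rfl⟩ := Nat.exists_eq_add_of_le hmn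
    exact (hVmem _ _).2 ⟨(U ^ k) y, by rw [pow_add]; rfl⟩
  have hpowinj : ∀ n : ℕ, Function.Injective (U ^ n : X →L[ℝ] X) := by
    intro n
    induction n with
    | zero => exact Function.injective_id
    | succ n ih =>
      rw [pow_succ]
      exact ih.comp hinj
  have hx : ∀ n : ℕ, ∃ x ∈ V n, ‖x‖ ≤ 3 ∧ ∀ y ∈ V (n + 1), 1 ≤ ‖x - y‖ := by
    intro n
    have h1 : IsClosed ((V (n + 1)).comap (V n).subtype : Set (V n)) :=
      (hVclosed (n + 1)).preimage continuous_subtype_val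
    have h2 : ∃ x : V n, x ∉ (V (n + 1)).comap (V n).subtype := by
      obtain ⟨z, hz⟩ := not_forall.1 hsurj
      refine ⟨⟨(U ^ n) z, (hVmem _ _).2 ⟨z, rfl⟩⟩, ?_⟩
      rintro ⟨y, hy⟩
      refine hz ⟨y, hpowinj n ?_⟩
      have : (U ^ (n + 1)) y = (U ^ n) z := hy
      rw [pow_succ] at this
      exact this
    obtain ⟨⟨x, hx⟩, hxn, hxy⟩ := riesz_lemma_of_norm_lt (c := (2 : ℝ)) (R := 3) (by norm_num)
      (by norm_num) h1 h2
    refine ⟨x, hx, hxn, fun y hy => ?_⟩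
    exact hxy ⟨y, hVanti n (n + 1) n.le_succ hy⟩ hy
  choose f hfV hfn hfy using hx
  have hSV : ∀ n x, x ∈ V n → S x ∈ V n := by
    intro n x hx
    obtain ⟨y, rfl⟩ := (hVmem _ _).1 hx
    have hc : Commute S (U ^ n) := ((Commute.one_right S).sub_right (Commute.refl S)).pow_right n
    exact (hVmem _ _).2 ⟨S y, (congrArg (fun T : X →L[ℝ] X => T y) hc.eq).symm⟩
  have hUV : ∀ n x, x ∈ V n → U x ∈ V (n + 1) := by
    intro n x hx
    obtain ⟨y, rfl⟩ := (hVmem _ _).1 hx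
    exact (hVmem _ _).2 ⟨y, by rw [pow_succ']; rfl⟩
  have hsep : ∀ m n, m < n →
      1 ≤ ‖(S * S : X →L[ℝ] X) (f m) - (S * S : X →L[ℝ] X) (f n)‖ := by
    intro m n hmn
    have hmem : U (f m + S (f m)) + S (S (f n)) ∈ V (m + 1) :=
      (V (m + 1)).add_mem (hUV m _ ((V m).add_mem (hfV m) (hSV m _ (hfV m))))
        (hSV _ _ (hSV _ _ (hVanti (m + 1) n hmn (hfV n))))
    refine (hfy m _ hmem).trans_eq (congrArg _ ?_)
    simp [hUdef]
    abel
  obtain ⟨Q, hQ, hQ'⟩ := hS.image_closedBall_subset_compact 3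
  obtain ⟨y, -, ψ, hψ, hy⟩ := hQ.tendsto_subseq (x := fun n => (S * S : X →L[ℝ] X) (f n))
    (fun n => hQ' ⟨f n, by simpa using hfn n, rfl⟩)
  have hc := hy.cauchySeq
  rw [Metric.cauchySeq_iff] at hc
  obtain ⟨N, hN⟩ := hc 1 one_pos
  have h1 := hN N le_rfl (N + 1) N.le_succ
  rw [dist_eq_norm] at h1
  exact absurd (hsep _ _ (hψ N.lt_succ_self)) (not_le.2 h1)

/-- If `S²` is compact and `1 - S` is surjective, then `1 - S` is injective: a bounded right inverse
is again of the form `1 - S'` with `S'²` compact, and it is injective, hence bijective. -/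
theorem bijective_of_surjective {S : X →L[ℝ] X} (hS : IsCompactOperator (S * S : X →L[ℝ] X))
    (hker : (LinearMap.ker ((1 - S : X →L[ℝ] X) : X →ₗ[ℝ] X)).ClosedComplemented)
    (hsurj : Function.Surjective (1 - S : X →L[ℝ] X)) :
    Function.Bijective (1 - S : X →L[ℝ] X) := by
  obtain ⟨V, hV⟩ : ∃ V : X →L[ℝ] X, (1 - S) * V = 1 := by
    set U : X →L[ℝ] X := 1 - S
    obtain ⟨P, hP⟩ := hker
    let M : Submodule ℝ X := LinearMap.ker P.toLinearMap
    have hM : ∀ x, x ∈ M ↔ P x = 0 := fun x => Iff.rfl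
    have hMc : IsClosed (M : Set X) := P.isClosed_ker
    have : CompleteSpace M := hMc.completeSpace_coe
    have hbij : Function.Bijective (U ∘L M.subtypeL) := by
      constructor
      · rw [injective_iff_map_eq_zero]
        intro x hx
        have h1 := hP ⟨x, hx⟩
        rw [(hM _).1 x.2] at h1
        exact Subtype.ext (congrArg Subtype.val h1).symm
      · intro y
        obtain ⟨x, rfl⟩ := hsurj y
        have hz : U (P x) = 0 := (P x).2
        exact ⟨⟨x - P x, (hM _).2 (by simp [hP])⟩, by simp [hz]⟩
    let e := ContinuousLinearEquiv.ofBijective (U ∘L M.subtypeL)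
      (LinearMap.ker_eq_bot.2 hbij.1) (LinearMap.range_eq_top.2 hbij.2)
    refine ⟨M.subtypeL ∘L (e.symm : X →L[ℝ] M), ?_⟩
    ext x
    exact e.apply_symm_apply x
  -- `V = 1 + S V = 1 - S'` with `S' = -(S + S² V)`, which again has a compact square
  have hVS : V = 1 - (-(S + S * S * V)) := by
    have h1 : V = 1 + S * V := by
      rw [sub_mul, one_mul] at hV
      rw [← hV]
      abel
    calc V = 1 + S * V := h1
      _ = 1 + S * (1 + S * V) := congrArg (fun T => 1 + S * T) h1
      _ = 1 - (-(S + S * S * V)) := by noncomm_ring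
  have hS' : IsCompactOperator
      ((-(S + S * S * V)) * (-(S + S * S * V)) : X →L[ℝ] X) := by
    have e : (-(S + S * S * V)) * (-(S + S * S * V)) =
        S * S + S * ((S * S) * V) + (S * S) * (V * S) + (S * S) * (V * (S * S * V)) := by
      noncomm_ring
    rw [e]
    exact (((hS).add ((hS.comp_clm V).clm_comp S)).add (hS.comp_clm (V * S))).add
      (hS.comp_clm (V * (S * S * V)))
  have hVinj : Function.Injective V := by
    intro x y hxy
    have := congrArg (1 - S : X →L[ℝ] X) hxy
    have hV' : ∀ z, (1 - S : X →L[ℝ] X) (V z) = z := fun z =>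
      congrArg (fun T : X →L[ℝ] X => T z) hV
    rwa [hV', hV'] at this
  have hVsurj : Function.Surjective V := by
    rw [hVS] at hVinj ⊢
    exact surjective_of_injective hS' hVinj
  refine ⟨fun x y hxy => ?_, hsurj⟩
  have hV' : ∀ z, (1 - S : X →L[ℝ] X) (V z) = z := fun z =>
    congrArg (fun T : X →L[ℝ] X => T z) hV
  obtain ⟨a, rfl⟩ := hVsurj x
  obtain ⟨b, rfl⟩ := hVsurj y
  rw [hV', hV'] at hxy
  rw [hxy]

theorem finiteDimensional_ker {S : X →L[ℝ] X} (hS : IsCompactOperator (S * S : X →L[ℝ] X)) :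
    FiniteDimensional ℝ (LinearMap.ker ((1 - S : X →L[ℝ] X) : X →ₗ[ℝ] X)) := by
  set N := LinearMap.ker ((1 - S : X →L[ℝ] X) : X →ₗ[ℝ] X) with hN
  have h : ∀ x ∈ N, (S * S : X →L[ℝ] X) x = x := by
    intro x hx
    have h1 : x - S x = 0 := hx
    have h2 : S x = x := (sub_eq_zero.1 h1).symm
    change S (S x) = x
    rw [h2, h2]
  have hNc : IsClosed (N : Set X) := (1 - S : X →L[ℝ] X).isClosed_ker
  have : CompleteSpace N := hNc.completeSpace_coe
  have hid := IsCompactOperator.restrict' (f := ((S * S : X →L[ℝ] X) : X →ₗ[ℝ] X)) hS (V := N)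
    (fun x hx => by
      change (S * S : X →L[ℝ] X) x ∈ N
      rwa [h x hx])
  refine FiniteDimensional.of_isCompactOperator_id (𝕜 := ℝ) ?_
  refine (congrArg IsCompactOperator ?_).mp hid
  funext x
  exact Subtype.ext (h x x.2)

/-- If `S²` is compact, then `1 - S` is a Fredholm operator of index zero. A suitable perturbation of
finite rank, from the kernel into a complement of the range, makes `1 - S` either injective or
surjective, according to which of the two spaces is smaller; by the preceding results it is then
bijective, so that the two spaces have the same dimension. -/
theorem fredholm_index_zero {S : X →L[ℝ] X} (hS : IsCompactOperator (S * S : X →L[ℝ] X)) :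
    FiniteDimensional ℝ (LinearMap.ker ((1 - S : X →L[ℝ] X) : X →ₗ[ℝ] X)) ∧
    IsClosed (LinearMap.range ((1 - S : X →L[ℝ] X) : X →ₗ[ℝ] X) : Set X) ∧
    Nonempty (LinearMap.ker ((1 - S : X →L[ℝ] X) : X →ₗ[ℝ] X) ≃ₗ[ℝ]
      X ⧸ LinearMap.range ((1 - S : X →L[ℝ] X) : X →ₗ[ℝ] X)) := by
  have hfin := finiteDimensional_ker hS
  set U : X →L[ℝ] X := 1 - S with hU
  set N := LinearMap.ker (U : X →ₗ[ℝ] X) with hN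
  set G := LinearMap.range (U : X →ₗ[ℝ] X) with hG
  obtain ⟨P, hP⟩ := Submodule.ClosedComplemented.of_finiteDimensional N
  obtain ⟨σ, hσ⟩ := G.mkQ.exists_rightInverse_of_surjective
    (LinearMap.range_eq_top.2 G.mkQ_surjective)
  have hσ' : ∀ y, G.mkQ (σ y) = y := fun y => congrArg (fun T : X ⧸ G →ₗ[ℝ] X ⧸ G => T y) hσ
  have hUmk : ∀ x, G.mkQ (U x) = 0 := fun x =>
    (Submodule.Quotient.mk_eq_zero G).2 ⟨x, rfl⟩
  have hUN : ∀ z : N, U z = 0 := fun z => z.2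
  -- for a linear `φ : N → X ⧸ G`, perturb `U` by the finite-rank operator `σ ∘ φ ∘ P`
  have key : ∀ φ : N →ₗ[ℝ] X ⧸ G, Function.Injective φ ∨ Function.Surjective φ →
      Function.Bijective φ ∧ ∃ U' : X →L[ℝ] X, Function.Bijective U' ∧
        ∀ x, U' x = U x + σ (φ (P x)) := by
    intro φ hφ
    let Φ : N →L[ℝ] X := LinearMap.toContinuousLinearMap (σ ∘ₗ φ)
    have hΦ : ∀ z, Φ z = σ (φ z) := fun z => rfl
    let E : X →L[ℝ] X := Φ ∘L P
    have hE : IsCompactOperator E :=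
      (isCompactOperator_of_locallyCompactSpace_rng Φ).comp_clm P
    have hU' : U + E = 1 - (S - E) := by rw [hU]; abel
    have hS' : IsCompactOperator ((S - E) * (S - E) : X →L[ℝ] X) := by
      have e : (S - E) * (S - E) = S * S - S * E - E * (S - E) := by noncomm_ring
      rw [e]
      exact (hS.sub (hE.clm_comp S)).sub (hE.comp_clm (S - E))
    have hU'x : ∀ x, (U + E) x = U x + σ (φ (P x)) := fun x => rfl
    have hmk : ∀ x, G.mkQ ((U + E) x) = φ (P x) := fun x => by
      rw [hU'x, map_add, hUmk, hσ', zero_add]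
    have hbij : Function.Bijective (U + E) := by
      rcases hφ with hφ | hφ
      · have hinj : Function.Injective (U + E) := by
          rw [injective_iff_map_eq_zero]
          intro x hx
          have h1 : P x = 0 := hφ (by rw [← hmk, hx, map_zero, map_zero])
          have h2 : U x = 0 := by simpa [hU'x, h1] using hx
          have h3 := hP ⟨x, h2⟩
          rw [h1] at h3
          exact (congrArg Subtype.val h3).symm
        refine ⟨hinj, ?_⟩
        rw [hU'] at hinj ⊢
        exact surjective_of_injective hS' hinj
      · have hsurj : Function.Surjective (U + E) := by
          intro y
          obtain ⟨z, hz⟩ := hφ (G.mkQ y)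
          obtain ⟨x, hx⟩ : y - σ (φ z) ∈ G := by
            rw [← Submodule.Quotient.mk_eq_zero]
            change G.mkQ (y - σ (φ z)) = 0
            rw [map_sub, hσ', hz, sub_self]
          have hx' : U x = y - σ (φ z) := hx
          refine ⟨x - P x + z, ?_⟩
          have h1 : P (x - P x + z) = z := by simp [hP]
          rw [hU'x, h1, map_add, map_sub, hUN, hUN, hx']
          simp
        rw [hU'] at hsurj ⊢
        refine bijective_of_surjective hS' ?_ hsurj
        have := finiteDimensional_ker hS'
        exact Submodule.ClosedComplemented.of_finiteDimensional _
    refine ⟨⟨?_, ?_⟩, U + E, hbij, hU'x⟩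
    · rw [injective_iff_map_eq_zero]
      intro z hz
      obtain ⟨x, hx⟩ : σ (φ z) ∈ G := by simp [hz]
      have h1 : (U + E) (z : X) = 0 := by rw [hU'x, hP, hUN, hz]; simp
      have h2 := hbij.1 (h1.trans (map_zero _).symm)
      exact Subtype.ext h2
    · intro y
      obtain ⟨x, hx⟩ := hbij.2 (σ y)
      exact ⟨P x, by rw [← hmk, hx, hσ']⟩
  obtain ⟨φ, hφ⟩ : ∃ φ : N →ₗ[ℝ] X ⧸ G, Function.Injective φ ∨ Function.Surjective φ := by
    rcases le_total (Module.rank ℝ N) (Module.rank ℝ (X ⧸ G)) with h | h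
    · obtain ⟨φ, hφ⟩ := rank_le_iff_exists_linearMap.1 h
      exact ⟨φ, Or.inl hφ⟩
    · obtain ⟨ψ, hψ⟩ := rank_le_iff_exists_linearMap.1 h
      obtain ⟨φ, hφ⟩ := ψ.exists_leftInverse_of_injective (LinearMap.ker_eq_bot.2 hψ)
      exact ⟨φ, Or.inr fun y => ⟨ψ y, congrArg (fun T : X ⧸ G →ₗ[ℝ] X ⧸ G => T y) hφ⟩⟩
  obtain ⟨hbij, U', hU', hU'x⟩ := key φ hφ
  refine ⟨hfin, ?_, ⟨LinearEquiv.ofBijective φ hbij⟩⟩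
  -- `range U` is the image of the closed subspace `ker P` under the isomorphism `U'`
  have hhomeo : IsClosedMap U' :=
    (ContinuousLinearEquiv.ofBijective U' (LinearMap.ker_eq_bot.2 hU'.1)
      (LinearMap.range_eq_top.2 hU'.2)).toHomeomorph.isClosedMap
  have hGeq : (G : Set X) = U' '' {x | P x = 0} := by
    ext y
    constructor
    · rintro ⟨x, rfl⟩
      refine ⟨x - P x, by simp [hP], ?_⟩
      rw [hU'x]
      simp [hP, hUN]
    · rintro ⟨x, hx, rfl⟩
      rw [mem_ofPred_eq] at hx
      refine ⟨x, ?_⟩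
      rw [hU'x, hx]
      simp
  rw [hGeq]
  exact hhomeo _ (isClosed_eq P.continuous continuous_const)

end SquareCompact

/-! ### Families of functions that are equicontinuous on the unit ball -/

namespace HypStrip

open Filter Topology MeasureTheory

/-- The functions `Ψ v`, `‖v‖ ≤ 1`, are equicontinuous at `p₀`, for a family `Ψ` that depends
homogeneously on `v`; equivalently, if `Ψ` is linear in `v`, the functional `Ψ · p` depends
continuously in norm on `p` at `p₀`. -/
def BallEquicontAt {V P : Type*} [SeminormedAddCommGroup V] [TopologicalSpace P]
    (Ψ : V → P → ℝ) (p₀ : P) : Prop :=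
  ∀ ε : ℝ, 0 < ε → ∀ᶠ p in 𝓝 p₀, ∀ v, |Ψ v p - Ψ v p₀| ≤ ε * ‖v‖

namespace BallEquicontAt

variable {V W P Q : Type*} [SeminormedAddCommGroup V] [SeminormedAddCommGroup W]
  [TopologicalSpace P] [TopologicalSpace Q]

theorem of_bound {Ψ : V → P → ℝ} {p₀ : P} (M : P → ℝ) (hM : ContinuousAt M p₀) (hM0 : M p₀ = 0)
    (h : ∀ p v, |Ψ v p - Ψ v p₀| ≤ M p * ‖v‖) : BallEquicontAt Ψ p₀ := by
  intro ε hε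
  have : ∀ᶠ p in 𝓝 p₀, M p < ε := hM.eventually_lt continuousAt_const (by rwa [hM0])
  filter_upwards [this] with p hp v
  exact (h p v).trans (mul_le_mul_of_nonneg_right hp.le (norm_nonneg v))

theorem of_approx {Ψ : V → P → ℝ} {p₀ : P}
    (h : ∀ ε : ℝ, 0 < ε → ∃ Φ : V → P → ℝ, BallEquicontAt Φ p₀ ∧
      ∀ᶠ p in 𝓝 p₀, ∀ v, |Ψ v p - Φ v p| ≤ ε * ‖v‖) : BallEquicontAt Ψ p₀ := by
  intro ε hε
  obtain ⟨Φ, hΦ, happ⟩ := h (ε / 3) (by positivity)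
  have h0 := happ.self_of_nhds
  filter_upwards [hΦ (ε / 3) (by positivity), happ] with p h1 h2 v
  have h3 := abs_le.1 (h1 v)
  have h4 := abs_le.1 (h2 v)
  have h5 := abs_le.1 (h0 v)
  exact abs_le.2 ⟨by linarith [h3.1, h4.1, h5.2], by linarith [h3.2, h4.2, h5.1]⟩

theorem add {Ψ Φ : V → P → ℝ} {p₀ : P} (hΨ : BallEquicontAt Ψ p₀) (hΦ : BallEquicontAt Φ p₀) :
    BallEquicontAt (fun v p => Ψ v p + Φ v p) p₀ := by
  intro ε hε
  filter_upwards [hΨ (ε / 2) (by positivity), hΦ (ε / 2) (by positivity)] with p h1 h2 v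
  have h3 := abs_le.1 (h1 v)
  have h4 := abs_le.1 (h2 v)
  exact abs_le.2 ⟨by linarith [h3.1, h4.1], by linarith [h3.2, h4.2]⟩

theorem neg {Ψ : V → P → ℝ} {p₀ : P} (hΨ : BallEquicontAt Ψ p₀) :
    BallEquicontAt (fun v p => -Ψ v p) p₀ := by
  intro ε hε
  filter_upwards [hΨ ε hε] with p h1 v
  rw [neg_sub_neg, abs_sub_comm]
  exact h1 v

theorem sub {Ψ Φ : V → P → ℝ} {p₀ : P} (hΨ : BallEquicontAt Ψ p₀) (hΦ : BallEquicontAt Φ p₀) :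
    BallEquicontAt (fun v p => Ψ v p - Φ v p) p₀ := by
  simpa only [sub_eq_add_neg] using hΨ.add hΦ.neg

theorem sum {ι : Type*} (s : Finset ι) {Ψ : ι → V → P → ℝ} {p₀ : P}
    (h : ∀ i ∈ s, BallEquicontAt (Ψ i) p₀) :
    BallEquicontAt (fun v p => ∑ i ∈ s, Ψ i v p) p₀ := by
  classical
  induction s using Finset.induction_on with
  | empty =>
    intro ε hε
    refine Eventually.of_forall fun p v => ?_
    simpa using mul_nonneg hε.le (norm_nonneg v)
  | insert i s hi ih =>
    simp only [Finset.sum_insert hi]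
    exact (h i (Finset.mem_insert_self i s)).add
      (ih fun j hj => h j (Finset.mem_insert_of_mem hj))

theorem comp_param {Ψ : V → P → ℝ} {g : Q → P} {q₀ : Q} (hΨ : BallEquicontAt Ψ (g q₀))
    (hg : ContinuousAt g q₀) : BallEquicontAt (fun v q => Ψ v (g q)) q₀ :=
  fun ε hε => hg.eventually (hΨ ε hε)

theorem comp_bounded {Ψ : V → P → ℝ} {p₀ : P} (hΨ : BallEquicontAt Ψ p₀) (L : W → V) (C : ℝ)
    (hL : ∀ w, ‖L w‖ ≤ C * ‖w‖) : BallEquicontAt (fun w p => Ψ (L w) p) p₀ := by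
  intro ε hε
  filter_upwards [hΨ (ε / (|C| + 1)) (by positivity)] with p h w
  refine (h (L w)).trans ?_
  have h1 : ‖L w‖ ≤ (|C| + 1) * ‖w‖ :=
    (hL w).trans (mul_le_mul_of_nonneg_right (by linarith [le_abs_self C]) (norm_nonneg w))
  calc ε / (|C| + 1) * ‖L w‖ ≤ ε / (|C| + 1) * ((|C| + 1) * ‖w‖) := by gcongr
    _ = ε * ‖w‖ := by field_simp

end BallEquicontAt

/-! ### Smoothing by integration along a moving point -/

section Smoothing

variable {P : Type*} [TopologicalSpace P]

theorem abs_primitive_sub_le (h : ℝ →ᵇ ℝ) (y y' : ℝ) :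
    |(∫ s in (0 : ℝ)..y, h s) - ∫ s in (0 : ℝ)..y', h s| ≤ ‖h‖ * |y - y'| := by
  rw [intervalIntegral.integral_interval_sub_left (h.continuous.intervalIntegrable _ _)
    (h.continuous.intervalIntegrable _ _)]
  exact intervalIntegral.norm_integral_le_of_norm_le_const fun s _ => h.norm_coe_le_norm s

theorem abs_primitive_le (h : ℝ →ᵇ ℝ) (y : ℝ) :
    |∫ s in (0 : ℝ)..y, h s| ≤ ‖h‖ * |y| := by
  simpa using abs_primitive_sub_le h y 0

theorem hasDerivAt_primitive (h : ℝ →ᵇ ℝ) (y : ℝ) :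
    HasDerivAt (fun y => ∫ s in (0 : ℝ)..y, h s) (h y) y :=
  (h.continuous.integral_hasStrictDerivAt 0 y).hasDerivAt

theorem continuous_primitive (h : ℝ →ᵇ ℝ) : Continuous fun y => ∫ s in (0 : ℝ)..y, h s :=
  continuous_iff_continuousAt.2 fun y => (hasDerivAt_primitive h y).continuousAt

theorem ballEquicontAt_mul_primitive {g y : P → ℝ} (hg : Continuous g) (hy : Continuous y)
    (p₀ : P) :
    BallEquicontAt (fun (h : ℝ →ᵇ ℝ) p => g p * ∫ s in (0 : ℝ)..y p, h s) p₀ := by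
  refine BallEquicontAt.of_bound (fun p => |g p - g p₀| * |y p| + |g p₀| * |y p - y p₀|)
    (by fun_prop) (by simp) fun p h => ?_
  have e : (g p * ∫ s in (0 : ℝ)..y p, h s) - g p₀ * ∫ s in (0 : ℝ)..y p₀, h s =
      (g p - g p₀) * (∫ s in (0 : ℝ)..y p, h s)
        + g p₀ * ((∫ s in (0 : ℝ)..y p, h s) - ∫ s in (0 : ℝ)..y p₀, h s) := by ring
  rw [e]
  refine (abs_add_le _ _).trans ?_
  rw [abs_mul, abs_mul]
  have h1 := mul_le_mul_of_nonneg_left (abs_primitive_le h (y p)) (abs_nonneg (g p - g p₀))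
  have h2 := mul_le_mul_of_nonneg_left (abs_primitive_sub_le h (y p) (y p₀)) (abs_nonneg (g p₀))
  linarith

theorem ballEquicontAt_integral_primitive {g : ℝ → ℝ} (hg : Continuous g) {z : ℝ → P → ℝ}
    (hz : Continuous fun q : P × ℝ => z q.2 q.1) {B : P → ℝ} (hB : Continuous B) (p₀ : P) :
    BallEquicontAt (fun (h : ℝ →ᵇ ℝ) p =>
      ∫ ξ in (0 : ℝ)..B p, g ξ * ∫ s in (0 : ℝ)..z ξ p, h s) p₀ := by
  have hzp : ∀ p, Continuous fun ξ => z ξ p := fun p =>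
    hz.comp (continuous_const.prodMk continuous_id)
  have hz0 : Continuous fun q : P × ℝ => z q.2 p₀ := (hzp p₀).comp continuous_snd
  have hc1 : Continuous fun p => ∫ ξ in (0 : ℝ)..B p, |g ξ| * |z ξ p - z ξ p₀| :=
    intervalIntegral.continuous_parametric_intervalIntegral_of_continuous
      (f := fun p ξ => |g ξ| * |z ξ p - z ξ p₀|)
      ((hg.comp continuous_snd).abs.mul (hz.sub hz0).abs) hB
  have hc2 : Continuous fun p => ∫ ξ in B p₀..B p, |g ξ| * |z ξ p₀| :=
    intervalIntegral.continuous_parametric_intervalIntegral_of_continuous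
      (f := fun _ ξ => |g ξ| * |z ξ p₀|)
      ((hg.comp continuous_snd).abs.mul hz0.abs) hB
  refine BallEquicontAt.of_bound (fun p => |(∫ ξ in (0 : ℝ)..B p, |g ξ| * |z ξ p - z ξ p₀|)|
    + |(∫ ξ in B p₀..B p, |g ξ| * |z ξ p₀|)|) (hc1.abs.add hc2.abs).continuousAt (by simp)
    fun p h => ?_
  have hcont : ∀ p, Continuous fun ξ => g ξ * ∫ s in (0 : ℝ)..z ξ p, h s := fun p =>
    hg.mul ((continuous_primitive h).comp (hzp p))
  have hint : ∀ p a b, IntervalIntegrable (fun ξ => g ξ * ∫ s in (0 : ℝ)..z ξ p, h s) volume a b :=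
    fun p a b => (hcont p).intervalIntegrable a b
  have e : (∫ ξ in (0 : ℝ)..B p, g ξ * ∫ s in (0 : ℝ)..z ξ p, h s)
      - (∫ ξ in (0 : ℝ)..B p₀, g ξ * ∫ s in (0 : ℝ)..z ξ p₀, h s)
      = (∫ ξ in (0 : ℝ)..B p, ((g ξ * ∫ s in (0 : ℝ)..z ξ p, h s)
          - g ξ * ∫ s in (0 : ℝ)..z ξ p₀, h s))
        + ∫ ξ in B p₀..B p, g ξ * ∫ s in (0 : ℝ)..z ξ p₀, h s := by
    rw [intervalIntegral.integral_sub (hint _ _ _) (hint _ _ _),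
      ← intervalIntegral.integral_interval_sub_left (hint p₀ 0 (B p)) (hint p₀ 0 (B p₀))]
    ring
  have h1 : ‖∫ ξ in (0 : ℝ)..B p, ((g ξ * ∫ s in (0 : ℝ)..z ξ p, h s)
          - g ξ * ∫ s in (0 : ℝ)..z ξ p₀, h s)‖
      ≤ |(∫ ξ in (0 : ℝ)..B p, |g ξ| * |z ξ p - z ξ p₀| * ‖h‖)| := by
    refine intervalIntegral.norm_integral_le_abs_of_norm_le (ae_of_all _ fun ξ => ?_)
      (Continuous.intervalIntegrable (μ := volume) ?_ _ _)
    · rw [← mul_sub, Real.norm_eq_abs, abs_mul, mul_assoc]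
      refine mul_le_mul_of_nonneg_left ?_ (abs_nonneg _)
      rw [mul_comm]
      exact abs_primitive_sub_le h _ _
    · exact (hg.abs.mul ((hzp p).sub (hzp p₀)).abs).mul continuous_const
  have h2 : ‖∫ ξ in B p₀..B p, g ξ * ∫ s in (0 : ℝ)..z ξ p₀, h s‖
      ≤ |(∫ ξ in B p₀..B p, |g ξ| * |z ξ p₀| * ‖h‖)| := by
    refine intervalIntegral.norm_integral_le_abs_of_norm_le (ae_of_all _ fun ξ => ?_)
      (Continuous.intervalIntegrable (μ := volume) ?_ _ _)
    · rw [Real.norm_eq_abs, abs_mul, mul_assoc]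
      refine mul_le_mul_of_nonneg_left ?_ (abs_nonneg _)
      rw [mul_comm]
      exact abs_primitive_le h _
    · exact (hg.abs.mul (hzp p₀).abs).mul continuous_const
  rw [e]
  refine (norm_add_le _ _).trans ((add_le_add h1 h2).trans_eq ?_)
  rw [intervalIntegral.integral_mul_const, intervalIntegral.integral_mul_const, abs_mul, abs_mul,
    abs_norm, add_mul]

/-- Integration by parts for `e (ξ) h (z (ξ)) z' (ξ)`, where `h` is only continuous. -/
theorem integral_polynomial_mul_comp (h : ℝ →ᵇ ℝ) (e : Polynomial ℝ) {w w' : ℝ → ℝ}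
    (hw' : Continuous w')
    (hd : ∀ ξ ∈ Icc (0 : ℝ) 1, HasDerivWithinAt w (w' ξ) (Icc 0 1) ξ) {b : ℝ}
    (hb : b ∈ Icc (0 : ℝ) 1) (hw : Continuous w) :
    ∫ ξ in (0 : ℝ)..b, e.eval ξ * (h (w ξ) * w' ξ) =
      (e.eval b * ∫ s in (0 : ℝ)..w b, h s) - (e.eval 0 * ∫ s in (0 : ℝ)..w 0, h s)
        - ∫ ξ in (0 : ℝ)..b, e.derivative.eval ξ * ∫ s in (0 : ℝ)..w ξ, h s := by
  have hH : Continuous fun ξ => ∫ s in (0 : ℝ)..w ξ, h s := (continuous_primitive h).comp hw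
  have hc1 : Continuous fun ξ => e.eval ξ * (h (w ξ) * w' ξ) :=
    e.continuous.mul ((h.continuous.comp hw).mul hw')
  have hc2 : Continuous fun ξ => e.derivative.eval ξ * ∫ s in (0 : ℝ)..w ξ, h s :=
    e.derivative.continuous.mul hH
  rw [eq_sub_iff_add_eq, ← intervalIntegral.integral_add (hc1.intervalIntegrable _ _)
    (hc2.intervalIntegrable _ _)]
  refine intervalIntegral.integral_eq_sub_of_hasDerivAt_of_le
    (f := fun ξ => e.eval ξ * ∫ s in (0 : ℝ)..w ξ, h s) hb.1 (e.continuous.mul hH).continuousOn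
    (fun ξ hξ => ?_) ((hc1.add hc2).intervalIntegrable _ _)
  have hξ' : ξ ∈ Ioo (0 : ℝ) 1 := ⟨hξ.1, hξ.2.trans_le hb.2⟩
  have hdw : HasDerivAt w (w' ξ) ξ :=
    (hd ξ (Ioo_subset_Icc_self hξ')).hasDerivAt (Icc_mem_nhds hξ'.1 hξ'.2)
  refine ((e.hasDerivAt ξ).mul ((hasDerivAt_primitive h (w ξ)).comp ξ hdw)).congr_deriv ?_
  simp only [Function.comp_apply]
  ring

theorem ballEquicontAt_integral_polynomial (e : Polynomial ℝ) {z z' : ℝ → P → ℝ}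
    (hz : Continuous fun q : P × ℝ => z q.2 q.1) (hz' : Continuous fun q : P × ℝ => z' q.2 q.1)
    (hd : ∀ p, ∀ ξ ∈ Icc (0 : ℝ) 1, HasDerivWithinAt (fun ξ => z ξ p) (z' ξ p) (Icc 0 1) ξ)
    {B : P → ℝ} (hB : Continuous B) (hB1 : ∀ p, B p ∈ Icc (0 : ℝ) 1) (p₀ : P) :
    BallEquicontAt (fun (h : ℝ →ᵇ ℝ) p =>
      ∫ ξ in (0 : ℝ)..B p, e.eval ξ * (h (z ξ p) * z' ξ p)) p₀ := by
  have e1 : (fun (h : ℝ →ᵇ ℝ) p => ∫ ξ in (0 : ℝ)..B p, e.eval ξ * (h (z ξ p) * z' ξ p)) =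
      fun (h : ℝ →ᵇ ℝ) p => (e.eval (B p) * ∫ s in (0 : ℝ)..z (B p) p, h s)
        - (e.eval 0 * ∫ s in (0 : ℝ)..z 0 p, h s)
        - ∫ ξ in (0 : ℝ)..B p, e.derivative.eval ξ * ∫ s in (0 : ℝ)..z ξ p, h s := by
    funext h p
    exact integral_polynomial_mul_comp h e (hz'.comp (continuous_const.prodMk continuous_id))
      (hd p) (hB1 p) (hz.comp (continuous_const.prodMk continuous_id))
  rw [e1]
  refine BallEquicontAt.sub (BallEquicontAt.sub ?_ ?_) ?_
  · exact ballEquicontAt_mul_primitive (e.continuous.comp hB)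
      (hz.comp (continuous_id.prodMk hB)) p₀
  · exact ballEquicontAt_mul_primitive continuous_const
      (hz.comp (continuous_id.prodMk continuous_const)) p₀
  · exact ballEquicontAt_integral_primitive e.derivative.continuous hz hB p₀

theorem ballEquicontAt_integral_zero {E z z' : ℝ → P → ℝ}
    (hE : Continuous fun q : P × ℝ => E q.2 q.1)
    (hz : Continuous fun q : P × ℝ => z q.2 q.1) (hz' : Continuous fun q : P × ℝ => z' q.2 q.1)
    (hd : ∀ p, ∀ ξ ∈ Icc (0 : ℝ) 1, HasDerivWithinAt (fun ξ => z ξ p) (z' ξ p) (Icc 0 1) ξ)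
    {B : P → ℝ} (hB : Continuous B) (hB1 : ∀ p, B p ∈ Icc (0 : ℝ) 1) (p₀ : P) :
    BallEquicontAt (fun (h : ℝ →ᵇ ℝ) p =>
      ∫ ξ in (0 : ℝ)..B p, E ξ p * (h (z ξ p) * z' ξ p)) p₀ := by
  have hEp : ∀ p, Continuous fun ξ => E ξ p := fun p =>
    hE.comp (continuous_const.prodMk continuous_id)
  have hzp : ∀ p, Continuous fun ξ => z ξ p := fun p =>
    hz.comp (continuous_const.prodMk continuous_id)
  have hz'p : ∀ p, Continuous fun ξ => z' ξ p := fun p =>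
    hz'.comp (continuous_const.prodMk continuous_id)
  refine BallEquicontAt.of_approx fun ε hε => ?_
  obtain ⟨M, hM⟩ := isCompact_Icc.exists_bound_of_continuousOn (s := Icc (0 : ℝ) 1)
    (hz'p p₀).continuousOn
  have hM0 : 0 ≤ M := (norm_nonneg _).trans (hM 0 (by simp))
  obtain ⟨e, he⟩ := exists_polynomial_near_of_continuousOn 0 1 (fun ξ => E ξ p₀)
    (hEp p₀).continuousOn (ε / (M + 1)) (by positivity)
  refine ⟨_, ballEquicontAt_integral_polynomial e hz hz' hd hB hB1 p₀, ?_⟩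
  have hN : Continuous fun p => ∫ ξ in (0 : ℝ)..B p, |E ξ p - e.eval ξ| * |z' ξ p| :=
    intervalIntegral.continuous_parametric_intervalIntegral_of_continuous
      (f := fun p ξ => |E ξ p - e.eval ξ| * |z' ξ p|)
      ((hE.sub (e.continuous.comp continuous_snd)).abs.mul hz'.abs) hB
  have hN0 : ∫ ξ in (0 : ℝ)..B p₀, |E ξ p₀ - e.eval ξ| * |z' ξ p₀| < ε := by
    have h1 := intervalIntegral.norm_integral_le_of_norm_le_const (a := 0) (b := B p₀)
      (f := fun ξ => |E ξ p₀ - e.eval ξ| * |z' ξ p₀|) (C := ε / (M + 1) * M) (fun ξ hξ => by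
        rw [uIoc_of_le (hB1 p₀).1] at hξ
        have hξ' : ξ ∈ Icc (0 : ℝ) 1 := ⟨hξ.1.le, hξ.2.trans (hB1 p₀).2⟩
        rw [Real.norm_eq_abs, abs_mul, abs_abs, abs_abs, abs_sub_comm]
        exact mul_le_mul (he ξ hξ').le (hM ξ hξ') (abs_nonneg _) (by positivity))
    rw [sub_zero, abs_of_nonneg (hB1 p₀).1] at h1
    have h2 : ε / (M + 1) * M < ε := by
      rw [div_mul_eq_mul_div, div_lt_iff₀ (by positivity)]
      nlinarith
    calc _ ≤ _ := le_abs_self _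
      _ ≤ _ := h1
      _ ≤ ε / (M + 1) * M * 1 := mul_le_mul_of_nonneg_left (hB1 p₀).2 (by positivity)
      _ < ε := by rwa [mul_one]
  filter_upwards [hN.continuousAt.eventually_lt continuousAt_const hN0] with p hp h
  have hi1 : Continuous fun ξ => E ξ p * (h (z ξ p) * z' ξ p) :=
    (hEp p).mul ((h.continuous.comp (hzp p)).mul (hz'p p))
  have hi2 : Continuous fun ξ => e.eval ξ * (h (z ξ p) * z' ξ p) :=
    e.continuous.mul ((h.continuous.comp (hzp p)).mul (hz'p p))
  rw [← intervalIntegral.integral_sub (μ := volume) (hi1.intervalIntegrable _ _)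
    (hi2.intervalIntegrable _ _)]
  have h1 : ‖∫ ξ in (0 : ℝ)..B p,
      (E ξ p * (h (z ξ p) * z' ξ p) - e.eval ξ * (h (z ξ p) * z' ξ p))‖ ≤
      ∫ ξ in (0 : ℝ)..B p, |E ξ p - e.eval ξ| * |z' ξ p| * ‖h‖ := by
    refine intervalIntegral.norm_integral_le_of_norm_le (hB1 p).1
      (ae_of_all _ fun ξ _ => ?_) (Continuous.intervalIntegrable (μ := volume) ?_ _ _)
    · rw [← sub_mul, Real.norm_eq_abs, abs_mul, abs_mul, mul_assoc, mul_comm |z' ξ p|]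
      exact mul_le_mul_of_nonneg_left
        (mul_le_mul_of_nonneg_right (h.norm_coe_le_norm _) (abs_nonneg _)) (abs_nonneg _)
    · exact (((hEp p).sub e.continuous).abs.mul (hz'p p).abs).mul continuous_const
  rw [intervalIntegral.integral_mul_const] at h1
  exact h1.trans (mul_le_mul_of_nonneg_right hp.le (norm_nonneg h))

/-- The functional `h ↦ ∫ E (ξ, p) h (z (ξ, p)) ∂_ξ z (ξ, p) dξ` depends continuously in norm on
the parameter `p`, although `h` is only bounded and continuous: up to a small error `E (·, p)` is a
polynomial, and then the primitive of `h`, which is Lipschitz, takes the place of `h`. -/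
theorem ballEquicontAt_integral {E z z' : ℝ → P → ℝ}
    (hE : Continuous fun q : P × ℝ => E q.2 q.1)
    (hz : Continuous fun q : P × ℝ => z q.2 q.1) (hz' : Continuous fun q : P × ℝ => z' q.2 q.1)
    (hd : ∀ p, ∀ ξ ∈ Icc (0 : ℝ) 1, HasDerivWithinAt (fun ξ => z ξ p) (z' ξ p) (Icc 0 1) ξ)
    {A B : P → ℝ} (hA : Continuous A) (hA1 : ∀ p, A p ∈ Icc (0 : ℝ) 1)
    (hB : Continuous B) (hB1 : ∀ p, B p ∈ Icc (0 : ℝ) 1) (p₀ : P) :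
    BallEquicontAt (fun (h : ℝ →ᵇ ℝ) p =>
      ∫ ξ in A p..B p, E ξ p * (h (z ξ p) * z' ξ p)) p₀ := by
  have e : (fun (h : ℝ →ᵇ ℝ) p => ∫ ξ in A p..B p, E ξ p * (h (z ξ p) * z' ξ p)) =
      fun (h : ℝ →ᵇ ℝ) p => (∫ ξ in (0 : ℝ)..B p, E ξ p * (h (z ξ p) * z' ξ p))
        - ∫ ξ in (0 : ℝ)..A p, E ξ p * (h (z ξ p) * z' ξ p) := by
    funext h p
    have hc : Continuous fun ξ => E ξ p * (h (z ξ p) * z' ξ p) :=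
      (hE.comp (continuous_const.prodMk continuous_id)).mul
        ((h.continuous.comp (hz.comp (continuous_const.prodMk continuous_id))).mul
          (hz'.comp (continuous_const.prodMk continuous_id)))
    exact (intervalIntegral.integral_interval_sub_left (μ := volume) (hc.intervalIntegrable _ _)
      (hc.intervalIntegrable _ _)).symm
  rw [e]
  exact (ballEquicontAt_integral_zero hE hz hz' hd hB hB1 p₀).sub
    (ballEquicontAt_integral_zero hE hz hz' hd hA hA1 p₀)

end Smoothing

end HypStrip

/-! ### A compactness criterion in the space of bounded continuous functions -/

namespace HypStrip

open Filter Topology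

/-- An operator on `BC_n` is compact if the image of the unit ball is equicontinuous and tends to
zero as `|t| → ∞`, uniformly on the ball: Arzelà–Ascoli on `[0,1] × [-N,N]` provides a finite net
there, and outside all functions are small. -/
theorem isCompactOperator_of_ballEquicontAt {n : ℕ} (K : BCn n →L[ℝ] BCn n)
    (heq : ∀ (j : Fin n) (p₀ : Strip), BallEquicontAt (fun (v : BCn n) p => K v p j) p₀)
    (hdec : ∀ ε : ℝ, 0 < ε → ∃ N : ℝ, ∀ (v : BCn n) (x : unitInterval) (t : ℝ),
      N ≤ |t| → ‖K v (x, t)‖ ≤ ε * ‖v‖) : IsCompactOperator K := by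
  refine (isCompactOperator_iff_isCompact_closure_image_closedBall
    (K : BCn n →ₗ[ℝ] BCn n) one_pos).2 ?_
  refine TotallyBounded.isCompact_of_isClosed (TotallyBounded.closure ?_) isClosed_closure
  rw [Metric.totallyBounded_iff]
  intro ε hε
  obtain ⟨N, hN⟩ := hdec (ε / 4) (by positivity)
  let ι : C(unitInterval × Icc (-N) N, Strip) := ⟨fun q => (q.1, (q.2 : ℝ)), by fun_prop⟩
  let r : BCn n → (unitInterval × Icc (-N) N →ᵇ (Fin n → ℝ)) := fun u => u.compContinuous ι
  let A : Set (unitInterval × Icc (-N) N →ᵇ (Fin n → ℝ)) :=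
    (fun v => r (K v)) '' Metric.closedBall (0 : BCn n) 1
  have hA : IsCompact (closure A) := by
    refine BoundedContinuousFunction.arzela_ascoli (Metric.closedBall (0 : Fin n → ℝ) ‖K‖)
      (isCompact_closedBall _ _) A ?_ ?_
    · rintro f q ⟨v, hv, rfl⟩
      rw [mem_closedBall_zero_iff] at hv ⊢
      refine ((K v).norm_coe_le_norm (ι q)).trans ((K.le_opNorm v).trans ?_)
      exact mul_le_of_le_one_right (norm_nonneg K) hv
    · intro q₀
      rw [Metric.equicontinuousAt_iff_right]
      intro η hη
      have h1 : ∀ᶠ p in 𝓝 (ι q₀), ∀ (j : Fin n) (v : BCn n),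
          |K v p j - K v (ι q₀) j| ≤ η / 2 * ‖v‖ :=
        eventually_all.2 fun j => heq j (ι q₀) (η / 2) (by positivity)
      filter_upwards [ι.continuous.continuousAt.eventually h1] with q hq
      rintro ⟨f, v, hv, rfl⟩
      rw [mem_closedBall_zero_iff] at hv
      refine lt_of_le_of_lt ((dist_pi_le_iff (by positivity : 0 ≤ η / 2)).2 fun j => ?_)
        (half_lt_self hη)
      rw [dist_comm]
      exact (hq j v).trans (mul_le_of_le_one_right (by positivity) hv)
  obtain ⟨s, hsA, hsfin, hs⟩ :=
    Metric.finite_approx_of_totallyBounded (hA.totallyBounded.subset subset_closure) ε hε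
  have hsA' : ∀ f ∈ s, ∃ v, v ∈ Metric.closedBall (0 : BCn n) 1 ∧ r (K v) = f :=
    fun f hf => hsA hf
  choose! g hg using hsA'
  refine ⟨(fun f => K (g f)) '' s, hsfin.image _, ?_⟩
  rintro _ ⟨v, hv, rfl⟩
  obtain ⟨f, hf, hvf⟩ := mem_iUnion₂.1 (hs ⟨v, hv, rfl⟩)
  refine mem_iUnion₂.2 ⟨K (g f), ⟨f, hf, rfl⟩, ?_⟩
  obtain ⟨hgf, hrf⟩ := hg f hf
  rw [mem_closedBall_zero_iff] at hv hgf
  rw [Metric.mem_ball] at hvf ⊢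
  refine lt_of_le_of_lt ((BoundedContinuousFunction.dist_le (C := max (dist (r (K v)) f) (ε / 2))
    (le_max_of_le_left dist_nonneg)).2 ?_) (max_lt hvf (half_lt_self hε))
  rintro ⟨x, t⟩
  rcases le_total N |t| with ht | ht
  · refine le_max_of_le_right ?_
    rw [dist_eq_norm]
    refine (norm_sub_le _ _).trans ?_
    have h1 := (hN v x t ht).trans (mul_le_of_le_one_right (by positivity) hv)
    have h2 := (hN (g f) x t ht).trans (mul_le_of_le_one_right (by positivity) hgf)
    change ‖K v (x, t)‖ + ‖K (g f) (x, t)‖ ≤ _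
    linarith
  · refine le_max_of_le_left ?_
    have h1 := BoundedContinuousFunction.dist_coe_le_dist (f := r (K v)) (g := f)
      ((x, ⟨t, abs_le.1 ht⟩) : unitInterval × Icc (-N) N)
    have h2 : r (K (g f)) (x, ⟨t, abs_le.1 ht⟩) = f (x, ⟨t, abs_le.1 ht⟩) := by rw [hrf]
    rw [← h2] at h1
    exact h1

end HypStrip

/-! ### Derivative of the characteristics along a moving initial point -/

namespace HypStrip

open Filter Topology MeasureTheory

/-- The exponential of the integral of `g` along the characteristic through `(x, t)`, from `x` to
`ξ`. -/
noncomputable def charExp (α : BC ℝ) (g : Strip → ℝ) (ξ x : unitInterval) (t : ℝ) : ℝ :=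
  Real.exp (∫ η in (x : ℝ)..(ξ : ℝ), g (pr η, omega α (pr η) x t))

theorem ne_zero_of_le_abs {α : BC ℝ} {c : ℝ} (hc : 0 < c) (hle : ∀ p, c ≤ |α p|) (p : Strip) :
    α p ≠ 0 := fun h => by
  have := hle p
  rw [h, abs_zero] at this
  linarith

theorem continuous_charExp {α : BC ℝ} (hα : IsBC1 α) {c : ℝ} (hc : 0 < c)
    (hle : ∀ p, c ≤ |α p|) {g : Strip → ℝ} (hg : Continuous g) :
    Continuous fun q : unitInterval × Strip => charExp α g q.1 q.2.1 q.2.2 := by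
  refine Real.continuous_exp.comp ?_
  have hF : Continuous fun q : Strip × ℝ => g (pr q.2, omega α (pr q.2) q.1.1 q.1.2) := by
    have h0 : Continuous fun q : Strip × ℝ => pr q.2 := continuous_pr.comp continuous_snd
    exact hg.comp (h0.prodMk ((continuous_omega hα hc hle).comp (h0.prodMk continuous_fst)))
  have hF1 : ∀ p : Strip, Continuous fun η : ℝ => g (pr η, omega α (pr η) p.1 p.2) := fun p =>
    hF.comp (continuous_const.prodMk continuous_id)
  have e : (fun q : unitInterval × Strip => ∫ η in (q.2.1 : ℝ)..(q.1 : ℝ),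
      g (pr η, omega α (pr η) q.2.1 q.2.2)) = fun q =>
      (∫ η in (0 : ℝ)..(q.1 : ℝ), g (pr η, omega α (pr η) q.2.1 q.2.2))
        - ∫ η in (0 : ℝ)..(q.2.1 : ℝ), g (pr η, omega α (pr η) q.2.1 q.2.2) := by
    funext q
    exact (intervalIntegral.integral_interval_sub_left (μ := volume)
      ((hF1 q.2).intervalIntegrable _ _) ((hF1 q.2).intervalIntegrable _ _)).symm
  rw [e]
  have hF2 : Continuous (Function.uncurry fun (q : unitInterval × Strip) (η : ℝ) =>
      g (pr η, omega α (pr η) q.2.1 q.2.2)) :=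
    hF.comp ((continuous_snd.comp continuous_fst).prodMk continuous_snd)
  exact (intervalIntegral.continuous_parametric_intervalIntegral_of_continuous
    (μ := volume) hF2 (s := fun q => (q.1 : ℝ)) (by fun_prop)).sub
    (intervalIntegral.continuous_parametric_intervalIntegral_of_continuous
    (μ := volume) hF2 (s := fun q => (q.2.1 : ℝ)) (by fun_prop))

/-- Solutions of the linear equation `u' = Q u` on `[0,1]`. -/
theorem eq_mul_exp_of_hasDerivWithinAt {u Q : ℝ → ℝ} (hQ : Continuous Q)
    (hu : ∀ s ∈ Icc (0 : ℝ) 1, HasDerivWithinAt u (Q s * u s) (Icc 0 1) s)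
    {r s : ℝ} (hr : r ∈ Icc (0 : ℝ) 1) (hs : s ∈ Icc (0 : ℝ) 1) :
    u s = u r * Real.exp (∫ η in r..s, Q η) := by
  have hP : ∀ s, HasDerivAt (fun s => ∫ η in (0 : ℝ)..s, Q η) (Q s) s := fun s =>
    (hQ.integral_hasStrictDerivAt 0 s).hasDerivAt
  have hder : ∀ s ∈ Icc (0 : ℝ) 1, HasDerivWithinAt
      (fun s => u s * Real.exp (-∫ η in (0 : ℝ)..s, Q η)) 0 (Icc 0 1) s := by
    intro s hs
    refine ((hu s hs).mul (hP s).neg.exp.hasDerivWithinAt).congr_deriv ?_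
    ring
  have hconst := (convex_Icc (0 : ℝ) 1).norm_image_sub_le_of_norm_hasDerivWithin_le (C := 0)
    hder (fun _ _ => by simp) hr hs
  rw [zero_mul, norm_le_zero_iff, sub_eq_zero] at hconst
  have hsub : ∫ η in r..s, Q η = (∫ η in (0 : ℝ)..s, Q η) - ∫ η in (0 : ℝ)..r, Q η :=
    (intervalIntegral.integral_interval_sub_left (hQ.intervalIntegrable _ _)
      (hQ.intervalIntegrable _ _)).symm
  rw [hsub, Real.exp_sub, mul_div_assoc', eq_div_iff (Real.exp_pos _).ne']
  rw [Real.exp_neg, Real.exp_neg] at hconst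
  field_simp at hconst
  linarith

/-- The product of a differentiable function that vanishes at a point and of a function that is
continuous there is differentiable at that point. -/
theorem hasDerivWithinAt_mul_of_eq_zero {k M : ℝ → ℝ} {k' x : ℝ} {s : Set ℝ}
    (hk : HasDerivWithinAt k k' s x) (h0 : k x = 0) (hM : ContinuousWithinAt M s x) :
    HasDerivWithinAt (fun y => k y * M y) (k' * M x) s x := by
  rw [hasDerivWithinAt_iff_tendsto_slope] at hk ⊢
  refine (hk.mul (hM.mono_left (nhdsWithin_mono x sdiff_subset))).congr fun y => ?_
  simp only [slope_def_field, h0]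
  ring

theorem hasDerivAt_inv_speed {α αx αt : BC ℝ} (hα : HasPartials α αx αt) {c : ℝ} (hc : 0 < c)
    (hle : ∀ p, c ≤ |α p|) (x : unitInterval) (y : ℝ) :
    HasDerivAt (fun s => 1 / α (x, s)) (-αt (x, y) / α (x, y) ^ 2) y := by
  simpa only [one_div] using (hα.2 x y).fun_inv (ne_zero_of_le_abs hc hle (x, y))

theorem inv_speed_sub {α αx αt : BC ℝ} (hα : HasPartials α αx αt) {c : ℝ} (hc : 0 < c)
    (hle : ∀ p, c ≤ |α p|) (x : unitInterval) (y z : ℝ) :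
    1 / α (x, z) - 1 / α (x, y) =
      (∫ θ in (0 : ℝ)..1, -αt (x, y + θ * (z - y)) / α (x, y + θ * (z - y)) ^ 2) * (z - y) := by
  have hcont : Continuous fun s : ℝ => -αt (x, s) / α (x, s) ^ 2 :=
    ((αt.continuous.comp (by fun_prop)).neg).div ((α.continuous.comp (by fun_prop)).pow 2)
      fun s => pow_ne_zero 2 (ne_zero_of_le_abs hc hle _)
  have h := intervalIntegral.integral_unitInterval_deriv_eq_sub (𝕜 := ℝ)
    (f := fun s => 1 / α (x, s))
    (f' := fun s => -αt (x, s) / α (x, s) ^ 2) (z₀ := y) (z₁ := z - y)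
    (hcont.comp (by fun_prop)).continuousOn
    (fun t _ => hasDerivAt_inv_speed hα hc hle x _)
  simp only [smul_eq_mul, add_sub_cancel] at h
  rw [← h, mul_comm]

theorem omega_hasDerivWithinAt {α : BC ℝ} (hα : IsBC1 α) {c : ℝ} (hc : 0 < c)
    (hle : ∀ p, c ≤ |α p|) (x : unitInterval) (t : ℝ) :
    ∀ s ∈ Icc (0 : ℝ) 1, HasDerivWithinAt (fun s => omega α (pr s) x t)
      (1 / α (pr s, omega α (pr s) x t)) (Icc 0 1) s := by
  intro s hs
  have := (omega_spec hα hc hle x t).2 ⟨s, hs⟩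
  simpa only [pr_of_mem hs] using this

theorem omega_self {α : BC ℝ} (hα : IsBC1 α) {c : ℝ} (hc : 0 < c)
    (hle : ∀ p, c ≤ |α p|) (x : unitInterval) (t : ℝ) : omega α x x t = t :=
  (omega_spec hα hc hle x t).1

theorem abs_omega_sub_le {α : BC ℝ} (hα : IsBC1 α) {c : ℝ} (hc : 0 < c)
    (hle : ∀ p, c ≤ |α p|) (ξ x : unitInterval) (t : ℝ) : |omega α ξ x t - t| ≤ 1 / c := by
  have := (convex_Icc (0 : ℝ) 1).norm_image_sub_le_of_norm_hasDerivWithin_le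
    (C := 1 / c) (omega_hasDerivWithinAt hα hc hle x t) (fun s _ => by
      rw [Real.norm_eq_abs, abs_div, abs_one]
      exact one_div_le_one_div_of_le hc (hle _)) x.2 ξ.2
  rw [pr_coe, pr_coe, omega_self hα hc hle] at this
  refine this.trans (mul_le_of_le_one_right (by positivity) ?_)
  exact abs_le.2 ⟨by linarith [x.2.2, ξ.2.1], by linarith [x.2.1, ξ.2.2]⟩

/-- If the initial point `(s, w s)` moves, the value at `η` of the characteristic through it moves
with speed proportional to the difference of the slopes of `w` and of the characteristic. The
difference of the characteristics through `(s, w s)` and `(ξ, w ξ)` solves a linear equation, hence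
its value at `η` is its value at `s` times an exponential that is continuous in `s`. -/
theorem hasDerivWithinAt_omega_comp {α αx αt : BC ℝ} (hα : HasPartials α αx αt) {c : ℝ}
    (hc : 0 < c) (hle : ∀ p, c ≤ |α p|) (η ξ : unitInterval) {w : ℝ → ℝ} {w' : ℝ}
    (hw : HasDerivWithinAt w w' (Icc 0 1) ξ) :
    HasDerivWithinAt (fun s => omega α η (pr s) (w s))
      (charExp α (fun p => -αt p / α p ^ 2) η ξ (w ξ) * (w' - 1 / α (ξ, w ξ))) (Icc 0 1) ξ := by
  have hα1 : IsBC1 α := ⟨αx, αt, hα⟩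
  have hom := continuous_omega hα1 hc hle
  have hg : Continuous fun p : Strip => -αt p / α p ^ 2 :=
    αt.continuous.neg.div (α.continuous.pow 2) fun p => pow_ne_zero 2 (ne_zero_of_le_abs hc hle p)
  -- the difference quotient of `1 / α` between the two characteristics
  let V : ℝ → ℝ → ℝ → ℝ := fun r y z => ∫ θ in (0 : ℝ)..1,
    -αt (pr r, y + θ * (z - y)) / α (pr r, y + θ * (z - y)) ^ 2
  have hV : Continuous fun q : ℝ × ℝ × ℝ => V q.1 q.2.1 q.2.2 :=
    intervalIntegral.continuous_parametric_intervalIntegral_of_continuous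
      (f := fun (q : ℝ × ℝ × ℝ) θ => -αt (pr q.1, q.2.1 + θ * (q.2.2 - q.2.1)) /
        α (pr q.1, q.2.1 + θ * (q.2.2 - q.2.1)) ^ 2)
      (hg.comp ((continuous_pr.comp (by fun_prop)).prodMk (by fun_prop))) continuous_const
  let Y : ℝ → ℝ := fun r => omega α (pr r) ξ (w ξ)
  have hY : Continuous Y :=
    hom.comp (continuous_pr.prodMk (continuous_const (y := ((ξ, w ξ) : Strip))))
  let Z : ℝ × ℝ → ℝ → ℝ := fun q r => omega α (pr r) (pr q.1) q.2
  have hZ : Continuous fun q : (ℝ × ℝ) × ℝ => Z q.1 q.2 :=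
    hom.comp ((continuous_pr.comp (by fun_prop)).prodMk
      ((continuous_pr.comp (by fun_prop)).prodMk (by fun_prop)))
  let Q : ℝ × ℝ → ℝ → ℝ := fun q r => V r (Y r) (Z q r)
  have hQ : Continuous fun q : (ℝ × ℝ) × ℝ => Q q.1 q.2 :=
    hV.comp (continuous_snd.prodMk ((hY.comp continuous_snd).prodMk hZ))
  let M : ℝ × ℝ → ℝ := fun q => Real.exp (∫ r in q.1..(η : ℝ), Q q r)
  have hM : Continuous M := by
    refine Real.continuous_exp.comp ?_
    refine ((intervalIntegral.continuous_parametric_intervalIntegral_of_continuous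
      (μ := volume) (a₀ := (η : ℝ)) (f := Q) hQ (s := fun q => q.1) continuous_fst).neg).congr
        fun q => ?_
    exact (intervalIntegral.integral_symm (E := ℝ) (η : ℝ) q.1).symm
  have hYd := omega_hasDerivWithinAt hα1 hc hle ξ (w ξ)
  have hrel : ∀ s ∈ Icc (0 : ℝ) 1,
      omega α η (pr s) (w s) - omega α η ξ (w ξ) = (w s - Y s) * M (s, w s) := by
    intro s hs
    have h := eq_mul_exp_of_hasDerivWithinAt (u := fun r => Z (s, w s) r - Y r)
      (Q := Q (s, w s)) (hQ.comp (continuous_const.prodMk continuous_id)) (fun r hr => by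
        refine ((omega_hasDerivWithinAt hα1 hc hle (pr s) (w s) r hr).sub
          (hYd r hr)).congr_deriv ?_
        exact inv_speed_sub hα hc hle (pr r) (Y r) (Z (s, w s) r)) hs η.2
    have h1 : Z (s, w s) s = w s := omega_self hα1 hc hle _ _
    simp only [h1] at h
    simpa only [Z, Y, pr_coe] using h
  have hwc : ContinuousWithinAt (fun s => M (s, w s)) (Icc 0 1) ξ :=
    hM.continuousAt.comp_continuousWithinAt (continuousWithinAt_id.prodMk hw.continuousWithinAt)
  have hYξ : Y ξ = w ξ := by
    simp only [Y, pr_coe]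
    exact omega_self hα1 hc hle _ _
  have hk : HasDerivWithinAt (fun s => w s - Y s) (w' - 1 / α (ξ, w ξ)) (Icc 0 1) ξ := by
    have h := hw.sub (hYd ξ ξ.2)
    simp only [pr_coe, omega_self hα1 hc hle] at h
    exact h
  have hmain := hasDerivWithinAt_mul_of_eq_zero hk (by rw [hYξ, sub_self]) hwc
  have hMξ : M ((ξ : ℝ), w ξ) = charExp α (fun p => -αt p / α p ^ 2) η ξ (w ξ) := by
    simp [M, Q, V, Z, Y, charExp]
  rw [hMξ, mul_comm] at hmain
  have hz := hmain.add_const (omega α η ξ (w ξ))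
  refine hz.congr (fun s hs => ?_) ?_
  · rw [← hrel s hs, sub_add_cancel]
  · rw [← hrel ξ ξ.2, sub_add_cancel]

end HypStrip

/-! ### Integrals over a parameter and over triangles -/

namespace HypStrip

open Filter Topology MeasureTheory

/-- Integration over a compact set of parameters preserves equicontinuity. -/
theorem BallEquicontAt.integral_param {V W P : Type*} [SeminormedAddCommGroup V]
    [SeminormedAddCommGroup W] [TopologicalSpace P] {Ψ : V → unitInterval × P → ℝ} {p₀ : P}
    (hΨ : ∀ η, BallEquicontAt Ψ (η, p₀)) (L : W → unitInterval → V) (C : ℝ)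
    (hL : ∀ w η, ‖L w η‖ ≤ C * ‖w‖) {b : ℝ} (hb : b ∈ Icc (0 : ℝ) 1)
    (hint : ∀ w p, IntervalIntegrable (fun η => Ψ (L w (pr η)) (pr η, p)) volume 0 b) :
    BallEquicontAt (fun w p => ∫ η in (0 : ℝ)..b, Ψ (L w (pr η)) (pr η, p)) p₀ := by
  intro ε hε
  set ε' := ε / (|C| + 1) with hε'
  have hε'0 : 0 < ε' := by positivity
  have htube : ∀ᶠ p in 𝓝 p₀, ∀ η ∈ (univ : Set unitInterval), ∀ v,
      |Ψ v (η, p) - Ψ v (η, p₀)| ≤ ε' * ‖v‖ := by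
    refine isCompact_univ.eventually_forall_of_forall_eventually fun η₀ _ => ?_
    have h1 : ∀ᶠ z : P × unitInterval in 𝓝 (p₀, η₀), ∀ v,
        |Ψ v (z.2, z.1) - Ψ v (η₀, p₀)| ≤ ε' / 2 * ‖v‖ := by
      have hc : ContinuousAt (fun z : P × unitInterval => (z.2, z.1)) (p₀, η₀) := by fun_prop
      exact hc.eventually (hΨ η₀ (ε' / 2) (by positivity))
    have h2 : ∀ᶠ z : P × unitInterval in 𝓝 (p₀, η₀), ∀ v,
        |Ψ v (z.2, p₀) - Ψ v (η₀, p₀)| ≤ ε' / 2 * ‖v‖ := by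
      have hc : ContinuousAt (fun z : P × unitInterval => (z.2, p₀)) (p₀, η₀) := by fun_prop
      exact hc.eventually (hΨ η₀ (ε' / 2) (by positivity))
    filter_upwards [h1, h2] with z hz1 hz2 v
    have h3 := abs_le.1 (hz1 v)
    have h4 := abs_le.1 (hz2 v)
    exact abs_le.2 ⟨by linarith [h3.1, h4.2], by linarith [h3.2, h4.1]⟩
  filter_upwards [htube] with p hp w
  rw [← intervalIntegral.integral_sub (hint w p) (hint w p₀)]
  have h1 := intervalIntegral.norm_integral_le_of_norm_le_const (a := 0) (b := b)
    (f := fun η => Ψ (L w (pr η)) (pr η, p) - Ψ (L w (pr η)) (pr η, p₀))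
    (C := ε' * (|C| * ‖w‖)) (fun η _ => by
      refine (hp (pr η) (mem_univ _) _).trans (mul_le_mul_of_nonneg_left ?_ hε'0.le)
      exact (hL w _).trans (mul_le_mul_of_nonneg_right (le_abs_self C) (norm_nonneg w)))
  refine h1.trans ?_
  rw [sub_zero, abs_of_nonneg hb.1]
  calc ε' * (|C| * ‖w‖) * b ≤ ε' * (|C| * ‖w‖) * 1 :=
        mul_le_mul_of_nonneg_left hb.2 (by positivity)
    _ ≤ ε' * ((|C| + 1) * ‖w‖) := by
        rw [mul_one]
        gcongr
        linarith
    _ = ε * ‖w‖ := by rw [hε']; field_simp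

/-- Exchange of the order of integration over the triangle `0 < η < ξ < x`; the outer integral is
written over `[0,1]`, since the inner one vanishes for `η ≥ x`. -/
theorem integral_triangle {φ : ℝ → ℝ → ℝ} (hφ : Continuous (Function.uncurry φ)) {x : ℝ}
    (hx : x ∈ Icc (0 : ℝ) 1) :
    ∫ ξ in (0 : ℝ)..x, ∫ η in (0 : ℝ)..ξ, φ ξ η =
      ∫ η in (0 : ℝ)..1, ∫ ξ in η..max x η, φ ξ η := by
  let T : Set (ℝ × ℝ) := {q | q.2 < q.1}
  have hT : MeasurableSet T := measurableSet_lt measurable_snd measurable_fst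
  let ψ : ℝ → ℝ → ℝ := fun ξ η => T.indicator (Function.uncurry φ) (ξ, η)
  have hψ : IntegrableOn (Function.uncurry ψ) (uIoc 0 x ×ˢ uIoc 0 1) := by
    have h1 : IntegrableOn (Function.uncurry φ) (Icc 0 x ×ˢ Icc 0 1) :=
      hφ.continuousOn.integrableOn_compact (isCompact_Icc.prod isCompact_Icc)
    have h2 : Function.uncurry ψ = T.indicator (Function.uncurry φ) := by
      funext q
      rfl
    rw [h2]
    refine IntegrableOn.indicator (h1.mono_set ?_) hT
    rw [uIoc_of_le hx.1, uIoc_of_le zero_le_one]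
    exact prod_mono Ioc_subset_Icc_self Ioc_subset_Icc_self
  calc ∫ ξ in (0 : ℝ)..x, ∫ η in (0 : ℝ)..ξ, φ ξ η
      = ∫ ξ in (0 : ℝ)..x, ∫ η in (0 : ℝ)..1, ψ ξ η := by
        refine intervalIntegral.integral_congr fun ξ hξ => ?_
        rw [uIcc_of_le hx.1] at hξ
        have e : (fun η => ψ ξ η) = (Iio ξ).indicator (φ ξ) := by
          funext η
          simp [ψ, T, indicator_apply]
        simp only [e]
        rw [intervalIntegral.integral_of_le hξ.1, intervalIntegral.integral_of_le zero_le_one,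
          setIntegral_indicator measurableSet_Iio, integral_Ioc_eq_integral_Ioo]
        congr 2
        ext η
        simp only [mem_Ioo, mem_inter_iff, mem_Ioc, mem_Iio]
        exact ⟨fun h => ⟨⟨h.1, h.2.le.trans (hξ.2.trans hx.2)⟩, h.2⟩, fun h => ⟨h.1.1, h.2⟩⟩
    _ = ∫ η in (0 : ℝ)..1, ∫ ξ in (0 : ℝ)..x, ψ ξ η :=
        intervalIntegral_intervalIntegral_swap hψ
    _ = ∫ η in (0 : ℝ)..1, ∫ ξ in η..max x η, φ ξ η := by
        refine intervalIntegral.integral_congr fun η hη => ?_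
        rw [uIcc_of_le zero_le_one] at hη
        have e : (fun ξ => ψ ξ η) = (Ioi η).indicator (fun ξ => φ ξ η) := by
          funext ξ
          simp [ψ, T, indicator_apply]
        simp only [e]
        rw [intervalIntegral.integral_of_le hx.1,
          intervalIntegral.integral_of_le (le_max_right _ _), setIntegral_indicator measurableSet_Ioi]
        congr 2
        ext ξ
        simp only [mem_inter_iff, mem_Ioc, mem_Ioi, le_max_iff]
        constructor
        · rintro ⟨⟨_, h2⟩, h3⟩
          exact ⟨h3, Or.inl h2⟩
        · rintro ⟨h1, h2 | h2⟩
          · exact ⟨⟨hη.1.trans_lt h1, h2⟩, h1⟩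
          · exact absurd h1 (not_lt.2 h2)

/-- Exchange of the order of integration in `∫_a^x ∫_b^ξ φ (ξ, η) dη dξ`. -/
theorem integral_integral_swap_of_mem_Icc {φ : ℝ → ℝ → ℝ} (hφ : Continuous (Function.uncurry φ))
    {a b x : ℝ} (ha : a ∈ Icc (0 : ℝ) 1) (hx : x ∈ Icc (0 : ℝ) 1) :
    ∫ ξ in a..x, ∫ η in b..ξ, φ ξ η =
      (∫ η in (0 : ℝ)..1, ∫ ξ in max a η..max x η, φ ξ η)
        - ∫ η in (0 : ℝ)..b, ∫ ξ in a..x, φ ξ η := by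
  have hφ1 : ∀ ξ, Continuous (φ ξ) := fun ξ => hφ.comp (continuous_const.prodMk continuous_id)
  have hφ2 : ∀ η, Continuous fun ξ => φ ξ η := fun η =>
    hφ.comp (continuous_id.prodMk continuous_const)
  have hin : ∀ s : ℝ → ℝ, Continuous s → Continuous fun ξ => ∫ η in (0 : ℝ)..s ξ, φ ξ η :=
    fun s hs => intervalIntegral.continuous_parametric_intervalIntegral_of_continuous hφ hs
  have hid : Continuous fun ξ => ∫ η in (0 : ℝ)..ξ, φ ξ η := hin (fun ξ => ξ) continuous_id
  have hin2 : ∀ s : ℝ → ℝ, Continuous s → Continuous fun η => ∫ ξ in (0 : ℝ)..s η, φ ξ η :=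
    fun s hs => intervalIntegral.continuous_parametric_intervalIntegral_of_continuous
      (f := fun η ξ => φ ξ η) (hφ.comp continuous_swap) hs
  have hmax : ∀ y : ℝ, Continuous fun η => ∫ ξ in η..max y η, φ ξ η := by
    intro y
    refine ((hin2 (fun η => max y η) (by fun_prop)).sub (hin2 (fun η => η) continuous_id)).congr
      fun η => ?_
    exact intervalIntegral.integral_interval_sub_left (μ := volume)
      ((hφ2 η).intervalIntegrable _ _) ((hφ2 η).intervalIntegrable _ _)
  have h1 : ∫ ξ in a..x, ∫ η in b..ξ, φ ξ η =
      (∫ ξ in a..x, ∫ η in (0 : ℝ)..ξ, φ ξ η) - ∫ ξ in a..x, ∫ η in (0 : ℝ)..b, φ ξ η := by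
    rw [← intervalIntegral.integral_sub (μ := volume)
      (hid.intervalIntegrable _ _)
      ((hin (fun _ => b) continuous_const).intervalIntegrable _ _)]
    refine intervalIntegral.integral_congr fun ξ _ => ?_
    exact (intervalIntegral.integral_interval_sub_left (μ := volume)
      ((hφ1 ξ).intervalIntegrable _ _) ((hφ1 ξ).intervalIntegrable _ _)).symm
  have h2 : ∫ ξ in a..x, ∫ η in (0 : ℝ)..ξ, φ ξ η =
      ∫ η in (0 : ℝ)..1, ∫ ξ in max a η..max x η, φ ξ η := by
    rw [← intervalIntegral.integral_interval_sub_left (μ := volume) (a := 0)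
      (hid.intervalIntegrable _ _)
      (hid.intervalIntegrable _ _)]
    rw [integral_triangle hφ hx, integral_triangle hφ ha,
      ← intervalIntegral.integral_sub (μ := volume) ((hmax x).intervalIntegrable _ _)
        ((hmax a).intervalIntegrable _ _)]
    refine intervalIntegral.integral_congr fun η _ => ?_
    exact intervalIntegral.integral_interval_sub_left (μ := volume)
      ((hφ2 η).intervalIntegrable _ _) ((hφ2 η).intervalIntegrable _ _)
  have h3 : ∫ ξ in a..x, ∫ η in (0 : ℝ)..b, φ ξ η =
      ∫ η in (0 : ℝ)..b, ∫ ξ in a..x, φ ξ η := by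
    refine intervalIntegral_intervalIntegral_swap ?_
    have hc : IntegrableOn (Function.uncurry φ) (uIcc a x ×ˢ uIcc 0 b) :=
      hφ.continuousOn.integrableOn_compact (isCompact_uIcc.prod isCompact_uIcc)
    exact hc.mono_set (prod_mono uIoc_subset_uIcc uIoc_subset_uIcc)
  rw [h1, h2, h3]

end HypStrip

/-! ### The integral operators of the boundary value problem -/

namespace HypStrip

open Filter Topology MeasureTheory

namespace HyperbolicProblem

variable {n : ℕ} (S : HyperbolicProblem n)

theorem continuous_ω (j : Fin n) :
    Continuous fun q : unitInterval × Strip => S.ω j q.1 q.2.1 q.2.2 := by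
  obtain ⟨δ, hδ, hle⟩ := S.exists_speed_bound
  exact continuous_omega (S.a_bc1 j) hδ (hle j)

theorem a_ne_zero (j : Fin n) (p : Strip) : S.a j p ≠ 0 := by
  obtain ⟨δ, hδ, hle⟩ := S.exists_speed_bound
  exact ne_zero_of_le_abs hδ (hle j) p

theorem continuous_c (j : Fin n) :
    Continuous fun q : unitInterval × Strip => S.c j q.1 q.2.1 q.2.2 := by
  obtain ⟨δ, hδ, hle⟩ := S.exists_speed_bound
  exact continuous_charExp (S.a_bc1 j) hδ (hle j)
    ((S.b j j).continuous.div (S.a j).continuous (S.a_ne_zero j))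

theorem continuous_d (j : Fin n) :
    Continuous fun q : unitInterval × Strip => S.d j q.1 q.2.1 q.2.2 :=
  (S.continuous_c j).div ((S.a j).continuous.comp (continuous_fst.prodMk (S.continuous_ω j)))
    fun _ => S.a_ne_zero j _

theorem exists_d_bound : ∃ D : ℝ, 0 ≤ D ∧ ∀ j ξ x t, |S.d j ξ x t| ≤ D := by
  obtain ⟨δ, hδ, hle⟩ := S.exists_speed_bound
  refine ⟨(∑ j, Real.exp (‖S.b j j‖ / δ)) / δ, by positivity, fun j ξ x t => ?_⟩
  rw [d, dCoef, abs_div]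
  refine div_le_div₀ (by positivity) ?_ hδ (hle j _)
  exact (abs_cCoef_le hδ (hle j) _ _ _ _).trans
    (Finset.single_le_sum (f := fun j => Real.exp (‖S.b j j‖ / δ))
      (fun _ _ => (Real.exp_pos _).le) (Finset.mem_univ j))

/-- The point with first coordinate `ξ` on the `j`-th characteristic through `p`. -/
noncomputable def charPt (j : Fin n) (p : Strip) (ξ : ℝ) : Strip := (pr ξ, S.ω j (pr ξ) p.1 p.2)

theorem continuous_charPt (j : Fin n) : Continuous fun q : Strip × ℝ => S.charPt j q.1 q.2 := by
  have h0 : Continuous fun q : Strip × ℝ => pr q.2 := continuous_pr.comp continuous_snd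
  exact h0.prodMk ((S.continuous_ω j).comp (h0.prodMk continuous_fst))

theorem continuous_d_pr (j : Fin n) :
    Continuous fun q : Strip × ℝ => S.d j (pr q.2) q.1.1 q.1.2 :=
  (S.continuous_d j).comp ((continuous_pr.comp continuous_snd).prodMk continuous_fst)

/-- Integration of `g` along the `j`-th characteristic, from the entry point to `p`, with the
weight `d_j`. -/
noncomputable def charIntegral (j : Fin n) (g : Strip → ℝ) (p : Strip) : ℝ :=
  ∫ ξ in (S.entry j : ℝ)..(p.1 : ℝ), S.d j (pr ξ) p.1 p.2 * g (S.charPt j p ξ)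

theorem continuous_charIntegrand (j : Fin n) {g : Strip → ℝ} (hg : Continuous g) :
    Continuous fun q : Strip × ℝ => S.d j (pr q.2) q.1.1 q.1.2 * g (S.charPt j q.1 q.2) :=
  (S.continuous_d_pr j).mul (hg.comp (S.continuous_charPt j))

theorem intervalIntegrable_charIntegrand (j : Fin n) {g : Strip → ℝ} (hg : Continuous g)
    (p : Strip) (a b : ℝ) :
    IntervalIntegrable (fun ξ => S.d j (pr ξ) p.1 p.2 * g (S.charPt j p ξ)) volume a b :=
  ((S.continuous_charIntegrand j hg).comp
    (continuous_const.prodMk continuous_id)).intervalIntegrable _ _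

theorem continuous_charIntegral (j : Fin n) {g : Strip → ℝ} (hg : Continuous g) :
    Continuous (S.charIntegral j g) :=
  intervalIntegral.continuous_parametric_intervalIntegral_of_continuous
    (f := fun (p : Strip) ξ => S.d j (pr ξ) p.1 p.2 * g (S.charPt j p ξ))
    (S.continuous_charIntegrand j hg) (by fun_prop)

theorem charIntegral_add (j : Fin n) {g h : Strip → ℝ} (hg : Continuous g) (hh : Continuous h)
    (p : Strip) :
    S.charIntegral j (fun q => g q + h q) p = S.charIntegral j g p + S.charIntegral j h p := by
  simp only [charIntegral, mul_add]
  exact intervalIntegral.integral_add (S.intervalIntegrable_charIntegrand j hg _ _ _)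
    (S.intervalIntegrable_charIntegrand j hh _ _ _)

theorem charIntegral_smul (j : Fin n) (r : ℝ) (g : Strip → ℝ) (p : Strip) :
    S.charIntegral j (fun q => r * g q) p = r * S.charIntegral j g p := by
  simp only [charIntegral, mul_left_comm _ r]
  exact intervalIntegral.integral_const_mul _ _

theorem charIntegral_neg_sum (j : Fin n) (s : Finset (Fin n)) {g : Fin n → Strip → ℝ}
    (hg : ∀ k, Continuous (g k)) (p : Strip) :
    S.charIntegral j (fun q => -∑ k ∈ s, g k q) p = -∑ k ∈ s, S.charIntegral j (g k) p := by
  simp only [charIntegral, mul_neg, Finset.mul_sum]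
  rw [intervalIntegral.integral_neg, intervalIntegral.integral_finsetSum]
  exact fun k _ => S.intervalIntegrable_charIntegrand j (hg k) _ _ _

theorem abs_charIntegral_le {D : ℝ} (hD0 : 0 ≤ D) (hD : ∀ j ξ x t, |S.d j ξ x t| ≤ D)
    (j : Fin n) {g : Strip → ℝ} {M : ℝ} (hM0 : 0 ≤ M) (p : Strip)
    (hM : ∀ ξ, |g (S.charPt j p ξ)| ≤ M) : |S.charIntegral j g p| ≤ D * M := by
  have h := intervalIntegral.norm_integral_le_of_norm_le_const (a := (S.entry j : ℝ))
    (b := (p.1 : ℝ)) (f := fun ξ => S.d j (pr ξ) p.1 p.2 * g (S.charPt j p ξ)) (C := D * M)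
    (fun ξ _ => by
      rw [Real.norm_eq_abs, abs_mul]
      exact mul_le_mul (hD _ _ _ _) (hM ξ) (abs_nonneg _) hD0)
  refine h.trans (mul_le_of_le_one_right (by positivity) ?_)
  have h1 := (S.entry j).2
  have h2 := p.1.2
  exact abs_le.2 ⟨by linarith [h1.2, h2.1], by linarith [h1.1, h2.2]⟩

theorem continuous_component (f : BCn n) (j : Fin n) : Continuous fun q => f q j :=
  (continuous_apply j).comp f.continuous

theorem exists_characteristicIntegral_bound : ∃ M : ℝ, ∀ (f : BCn n) (p : Strip),
    ‖(fun j : Fin n => S.charIntegral j (fun q => f q j) p)‖ ≤ M * ‖f‖ := by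
  obtain ⟨D, hD0, hD⟩ := S.exists_d_bound
  refine ⟨D, fun f p => (pi_norm_le_iff_of_nonneg (by positivity)).2 fun j => ?_⟩
  exact S.abs_charIntegral_le hD0 hD j (norm_nonneg f) p fun ξ =>
    (norm_le_pi_norm _ j).trans (f.norm_coe_le_norm _)

/-- The operator `F` of integration along the characteristics,
`(F f)_j (x, t) = ∫_{x_j}^x d_j (ξ, x, t) f_j (ξ, ω_j (ξ, x, t)) dξ`. -/
noncomputable def F : BCn n →L[ℝ] BCn n :=
  LinearMap.mkContinuousOfExistsBound
    { toFun := fun f => BoundedContinuousFunction.ofNormedAddCommGroup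
        (fun p : Strip => fun j : Fin n => S.charIntegral j (fun q => f q j) p)
        (continuous_pi fun j => S.continuous_charIntegral j (continuous_component f j))
        (S.exists_characteristicIntegral_bound.choose * ‖f‖)
        (S.exists_characteristicIntegral_bound.choose_spec f)
      map_add' := fun f g => by
        ext p j
        exact S.charIntegral_add j (continuous_component f j) (continuous_component g j) p
      map_smul' := fun r f => by
        ext p j
        exact S.charIntegral_smul j r (fun q => f q j) p }
    (by
      obtain ⟨M, hM⟩ := S.exists_characteristicIntegral_bound
      refine ⟨|M|, fun f => ?_⟩
      refine (BoundedContinuousFunction.norm_le (by positivity)).2 fun p => ?_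
      exact (hM f p).trans (mul_le_mul_of_nonneg_right (le_abs_self M) (norm_nonneg f)))

theorem F_apply (f : BCn n) (p : Strip) (j : Fin n) :
    S.F f p j = S.charIntegral j (fun q => f q j) p := rfl

theorem continuous_offDiagonal (u : BCn n) :
    Continuous fun p : Strip => fun j : Fin n => -∑ k ∈ Finset.univ.erase j, S.b j k p * u p k :=
  continuous_pi fun j => (continuous_finsetSum _ fun k _ =>
    (S.b j k).continuous.mul (continuous_component u k)).neg

theorem exists_offDiagonal_bound : ∃ M : ℝ, ∀ (u : BCn n) (p : Strip),
    ‖(fun j : Fin n => -∑ k ∈ Finset.univ.erase j, S.b j k p * u p k)‖ ≤ M * ‖u‖ := by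
  refine ⟨∑ j, ∑ k, ‖S.b j k‖, fun u p => (pi_norm_le_iff_of_nonneg (by positivity)).2 fun j => ?_⟩
  rw [norm_neg]
  calc ‖∑ k ∈ Finset.univ.erase j, S.b j k p * u p k‖
      ≤ ∑ k ∈ Finset.univ.erase j, ‖S.b j k‖ * ‖u‖ := by
        refine norm_sum_le_of_le _ fun k _ => ?_
        rw [norm_mul]
        exact mul_le_mul ((S.b j k).norm_coe_le_norm p)
          ((norm_le_pi_norm _ k).trans (u.norm_coe_le_norm p)) (norm_nonneg _) (norm_nonneg _)
    _ ≤ ∑ k, ‖S.b j k‖ * ‖u‖ :=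
        Finset.sum_le_sum_of_subset_of_nonneg (Finset.erase_subset _ _) fun _ _ _ => by positivity
    _ = (∑ k, ‖S.b j k‖) * ‖u‖ := (Finset.sum_mul _ _ _).symm
    _ ≤ (∑ j, ∑ k, ‖S.b j k‖) * ‖u‖ := by
        refine mul_le_mul_of_nonneg_right ?_ (norm_nonneg u)
        exact Finset.single_le_sum (f := fun j => ∑ k, ‖S.b j k‖) (fun _ _ => by positivity)
          (Finset.mem_univ j)

/-- Multiplication by the off-diagonal part of the coefficient matrix, with a minus sign:
`(B u)_j = -∑_{k ≠ j} b_jk u_k`. -/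
noncomputable def B : BCn n →L[ℝ] BCn n :=
  LinearMap.mkContinuousOfExistsBound
    { toFun := fun u => BoundedContinuousFunction.ofNormedAddCommGroup
        (fun p : Strip => fun j : Fin n => -∑ k ∈ Finset.univ.erase j, S.b j k p * u p k)
        (S.continuous_offDiagonal u) (S.exists_offDiagonal_bound.choose * ‖u‖)
        (S.exists_offDiagonal_bound.choose_spec u)
      map_add' := fun u v => by
        ext p j
        change -∑ k ∈ Finset.univ.erase j, S.b j k p * (u p k + v p k) =
          -(∑ k ∈ Finset.univ.erase j, S.b j k p * u p k)
            + -∑ k ∈ Finset.univ.erase j, S.b j k p * v p k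
        simp only [mul_add, Finset.sum_add_distrib, neg_add]
      map_smul' := fun r u => by
        ext p j
        change -∑ k ∈ Finset.univ.erase j, S.b j k p * (r * u p k) =
          r * -∑ k ∈ Finset.univ.erase j, S.b j k p * u p k
        rw [mul_neg, Finset.mul_sum]
        simp only [mul_left_comm r] }
    (by
      obtain ⟨M, hM⟩ := S.exists_offDiagonal_bound
      refine ⟨|M|, fun u => ?_⟩
      refine (BoundedContinuousFunction.norm_le (by positivity)).2 fun p => ?_
      exact (hM u p).trans (mul_le_mul_of_nonneg_right (le_abs_self M) (norm_nonneg u)))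

theorem B_apply (u : BCn n) (p : Strip) (j : Fin n) :
    S.B u p j = -∑ k ∈ Finset.univ.erase j, S.b j k p * u p k := rfl

theorem F_B_apply (u : BCn n) (p : Strip) (j : Fin n) :
    S.F (S.B u) p j =
      -∑ k ∈ Finset.univ.erase j, S.charIntegral j (fun q => S.b j k q * u q k) p :=
  S.charIntegral_neg_sum j _ (g := fun k q => S.b j k q * u q k)
    (fun k => (S.b j k).continuous.mul (continuous_component u k)) p

/-- The integral equations in operator form. -/
theorem isBCSolution_iff (f u : BCn n) :
    S.IsBCSolution f u ↔ u = S.C u + S.F (S.B u + f) := by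
  have key : ∀ (j : Fin n) (x : unitInterval) (t : ℝ), (S.C u + S.F (S.B u + f)) (x, t) j =
      S.c j (S.entry j) x t * S.R u (S.ω j (S.entry j) x t) j
      - (∫ ξ in (S.entry j : ℝ)..(x : ℝ), S.d j (pr ξ) x t *
          ∑ k ∈ Finset.univ.erase j,
            S.b j k (pr ξ, S.ω j (pr ξ) x t) * u (pr ξ, S.ω j (pr ξ) x t) k)
      + ∫ ξ in (S.entry j : ℝ)..(x : ℝ), S.d j (pr ξ) x t * f (pr ξ, S.ω j (pr ξ) x t) j := by
    intro j x t
    rw [map_add]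
    change S.C u (x, t) j + (S.F (S.B u) (x, t) j + S.F f (x, t) j) = _
    rw [S.C_apply, S.F_apply, S.F_apply, ← add_assoc, sub_eq_add_neg,
      ← intervalIntegral.integral_neg]
    congr 2
    simp only [charIntegral, B_apply, mul_neg]
    rfl
  constructor
  · intro h
    ext ⟨x, t⟩ j
    rw [key]
    exact h j x t
  · intro h j x t
    rw [← key, ← h]

end HyperbolicProblem

end HypStrip

/-! ### Compactness of the iterated integral operators -/

namespace HypStrip

open Filter Topology MeasureTheory

namespace HyperbolicProblem

variable {n : ℕ} (S : HyperbolicProblem n)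

/-- Off-diagonal terms integrated along characteristics are small for large `|t|`, because a
characteristic that crosses the strip stays within bounded time of its initial point. -/
theorem norm_F_B_le (hvan : S.OffDiagonalVanishes) {ε : ℝ} (hε : 0 < ε) :
    ∃ N : ℝ, ∀ (v : BCn n) (x : unitInterval) (t : ℝ), N ≤ |t| →
      ‖S.F (S.B v) (x, t)‖ ≤ ε * ‖v‖ := by
  obtain ⟨δ, hδ, hle⟩ := S.exists_speed_bound
  obtain ⟨D, hD0, hD⟩ := S.exists_d_bound
  set ε' := ε / ((D + 1) * (n + 1)) with hε'
  have hε'0 : 0 < ε' := by positivity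
  obtain ⟨T₁, T₂, hT⟩ := hvan ε' hε'0
  refine ⟨|T₁| + |T₂| + 1 / δ + 1, fun v x t ht => ?_⟩
  refine (pi_norm_le_iff_of_nonneg (by positivity)).2 fun j => ?_
  have hpt : ∀ ξ, |S.B v (S.charPt j (x, t) ξ) j| ≤ (n + 1) * (ε' * ‖v‖) := by
    intro ξ
    have hω : S.ω j (pr ξ) x t ∉ Icc T₁ T₂ := by
      intro hmem
      have h1 := abs_omega_sub_le (S.a_bc1 j) hδ (hle j) (pr ξ) x t
      have h2 : |S.ω j (pr ξ) x t| ≤ |T₁| + |T₂| :=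
        abs_le.2 ⟨by linarith [hmem.1, neg_abs_le T₁, abs_nonneg T₂],
          by linarith [hmem.2, le_abs_self T₂, abs_nonneg T₁]⟩
      have h3 : |t| ≤ |S.ω j (pr ξ) x t| + |S.ω j (pr ξ) x t - t| := by
        rw [abs_sub_comm]
        simpa using abs_add_le (S.ω j (pr ξ) x t) (t - S.ω j (pr ξ) x t)
      have h4 : |S.ω j (pr ξ) x t - t| ≤ 1 / δ := h1
      linarith
    rw [B_apply, abs_neg]
    calc |∑ k ∈ Finset.univ.erase j,
          S.b j k (S.charPt j (x, t) ξ) * v (S.charPt j (x, t) ξ) k|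
        ≤ ∑ k ∈ Finset.univ.erase j, ε' * ‖v‖ := by
          refine (Finset.abs_sum_le_sum_abs _ _).trans (Finset.sum_le_sum fun k hk => ?_)
          rw [abs_mul]
          exact mul_le_mul (hT j k (Finset.ne_of_mem_erase hk).symm (pr ξ) _ hω).le
            ((norm_le_pi_norm _ k).trans (v.norm_coe_le_norm _)) (abs_nonneg _) hε'0.le
      _ ≤ ∑ _k : Fin n, ε' * ‖v‖ :=
          Finset.sum_le_sum_of_subset_of_nonneg (Finset.erase_subset _ _) fun _ _ _ => by positivity
      _ = n * (ε' * ‖v‖) := by simp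
      _ ≤ (n + 1) * (ε' * ‖v‖) := mul_le_mul_of_nonneg_right (by linarith) (by positivity)
  refine (S.abs_charIntegral_le hD0 hD j (g := fun q => S.B v q j)
    (M := (n + 1) * (ε' * ‖v‖)) (by positivity) (x, t) hpt).trans ?_
  calc D * ((n + 1) * (ε' * ‖v‖)) ≤ (D + 1) * ((n + 1) * (ε' * ‖v‖)) :=
        mul_le_mul_of_nonneg_right (by linarith) (by positivity)
    _ = ε * ‖v‖ := by
        rw [hε']
        field_simp

theorem isCompactOperator_F_B_comp (hvan : S.OffDiagonalVanishes) (L : BCn n →L[ℝ] BCn n)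
    (hL : ∀ j k : Fin n, j ≠ k → ∀ p₀ : Strip, BallEquicontAt
      (fun (v : BCn n) p => S.charIntegral j (fun q => S.b j k q * L v q k) p) p₀) :
    IsCompactOperator (S.F * S.B * L : BCn n →L[ℝ] BCn n) := by
  refine isCompactOperator_of_ballEquicontAt _ (fun j p₀ => ?_) fun ε hε => ?_
  · have e : (fun (v : BCn n) p => (S.F * S.B * L : BCn n →L[ℝ] BCn n) v p j) = fun v p =>
        -∑ k ∈ Finset.univ.erase j, S.charIntegral j (fun q => S.b j k q * L v q k) p := by
      funext v p
      exact S.F_B_apply (L v) p j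
    rw [e]
    exact (BallEquicontAt.sum _ fun k hk => hL j k (Finset.ne_of_mem_erase hk).symm p₀).neg
  · obtain ⟨N, hN⟩ := S.norm_F_B_le hvan (ε := ε / (‖L‖ + 1)) (by positivity)
    refine ⟨N, fun v x t ht => (hN (L v) x t ht).trans ?_⟩
    calc ε / (‖L‖ + 1) * ‖L v‖ ≤ ε / (‖L‖ + 1) * ((‖L‖ + 1) * ‖v‖) := by
          refine mul_le_mul_of_nonneg_left ?_ (by positivity)
          exact (L.le_opNorm v).trans
            (mul_le_mul_of_nonneg_right (by linarith) (norm_nonneg v))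
      _ = ε * ‖v‖ := by field_simp

/-- The value at `q` of the solution of the homogeneous `k`-th equation without coupling that
equals `h` at `x = η`. -/
noncomputable def transport (k : Fin n) (h : ℝ → ℝ) (η : unitInterval) (q : Strip) : ℝ :=
  S.c k η q.1 q.2 * h (S.ω k η q.1 q.2)

/-- The integral of `b_jk` times a function transported from `x = q.1` along the
`k`-characteristics, taken along the `j`-characteristic through `q.2` with the weight `d_j`. -/
noncomputable def transportIntegral (j k : Fin n) (A B : unitInterval × Strip → ℝ) (h : ℝ → ℝ)
    (q : unitInterval × Strip) : ℝ :=
  ∫ ξ in A q..B q, S.d j (pr ξ) q.2.1 q.2.2 *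
    (S.b j k (S.charPt j q.2 ξ) * S.transport k h q.1 (S.charPt j q.2 ξ))

/-- The smoothing effect behind the theorem. Along a `j`-characteristic, the foot
`ω_k (η, ·)` of the `k`-characteristic moves with a speed that contains the factor
`1 / a_j - 1 / a_k = (a_k - a_j) / (a_j a_k)`, which is also present in `b_jk`; hence the integral
of a transported function is of the form considered in `ballEquicontAt_integral`. -/
theorem ballEquicontAt_transport (hb : S.Factorizes) {j k : Fin n} (hjk : j ≠ k)
    {A B : unitInterval × Strip → ℝ} (hA : Continuous A) (hA1 : ∀ q, A q ∈ Icc (0 : ℝ) 1)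
    (hB : Continuous B) (hB1 : ∀ q, B q ∈ Icc (0 : ℝ) 1) (q₀ : unitInterval × Strip) :
    BallEquicontAt (fun (h : ℝ →ᵇ ℝ) q => S.transportIntegral j k A B h q) q₀ := by
  obtain ⟨δ, hδ, hle⟩ := S.exists_speed_bound
  obtain ⟨bt, -, hbt⟩ := hb j k hjk
  obtain ⟨αx, αt, hα⟩ := S.a_bc1 k
  let g : Strip → ℝ := fun p => -αt p / S.a k p ^ 2
  have hg : Continuous g := αt.continuous.neg.div ((S.a k).continuous.pow 2)
    fun p => pow_ne_zero 2 (S.a_ne_zero k p)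
  let Z : (unitInterval × Strip) × ℝ → unitInterval × Strip :=
    fun r => (r.1.1, S.charPt j r.1.2 r.2)
  have hpt : Continuous fun r : (unitInterval × Strip) × ℝ => S.charPt j r.1.2 r.2 :=
    (S.continuous_charPt j).comp ((continuous_snd.comp continuous_fst).prodMk continuous_snd)
  have hZ : Continuous Z := (continuous_fst.comp continuous_fst).prodMk hpt
  let e : unitInterval × Strip → ℝ := fun q => charExp (S.a k) g q.1 q.2.1 q.2.2
  have he : Continuous e := continuous_charExp ⟨αx, αt, hα⟩ hδ (hle k) hg
  have he0 : ∀ q, e q ≠ 0 := fun q => (Real.exp_pos _).ne'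
  let z : ℝ → unitInterval × Strip → ℝ := fun ξ q =>
    S.ω k q.1 (S.charPt j q.2 ξ).1 (S.charPt j q.2 ξ).2
  let z' : ℝ → unitInterval × Strip → ℝ := fun ξ q => e (q.1, S.charPt j q.2 ξ) *
    (1 / S.a j (S.charPt j q.2 ξ) - 1 / S.a k (S.charPt j q.2 ξ))
  let E : ℝ → unitInterval × Strip → ℝ := fun ξ q => S.d j (pr ξ) q.2.1 q.2.2 *
    bt (S.charPt j q.2 ξ) * S.c k q.1 (S.charPt j q.2 ξ).1 (S.charPt j q.2 ξ).2 *
    (S.a j (S.charPt j q.2 ξ) * S.a k (S.charPt j q.2 ξ)) / e (q.1, S.charPt j q.2 ξ)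
  have hz : Continuous fun r : (unitInterval × Strip) × ℝ => z r.2 r.1 :=
    (S.continuous_ω k).comp hZ
  have hz' : Continuous fun r : (unitInterval × Strip) × ℝ => z' r.2 r.1 :=
    (he.comp hZ).mul ((continuous_const.div ((S.a j).continuous.comp hpt)
      fun _ => S.a_ne_zero j _).sub (continuous_const.div ((S.a k).continuous.comp hpt)
      fun _ => S.a_ne_zero k _))
  have hE : Continuous fun r : (unitInterval × Strip) × ℝ => E r.2 r.1 :=
    ((((((S.continuous_d_pr j).comp ((continuous_snd.comp continuous_fst).prodMk
      continuous_snd)).mul (bt.continuous.comp hpt)).mul ((S.continuous_c k).comp hZ)).mul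
      (((S.a j).continuous.comp hpt).mul ((S.a k).continuous.comp hpt))).div (he.comp hZ)
      fun _ => he0 _)
  have hd : ∀ q, ∀ ξ ∈ Icc (0 : ℝ) 1,
      HasDerivWithinAt (fun ξ => z ξ q) (z' ξ q) (Icc 0 1) ξ := by
    intro q ξ hξ
    have hw := omega_hasDerivWithinAt (S.a_bc1 j) hδ (hle j) q.2.1 q.2.2 ξ hξ
    have h := hasDerivWithinAt_omega_comp hα hδ (hle k) q.1 ⟨ξ, hξ⟩
      (w := fun s => omega (S.a j) (pr s) q.2.1 q.2.2) hw
    simp only [← pr_of_mem hξ] at h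
    exact h
  have hmain := ballEquicontAt_integral hE hz hz' hd hA hA1 hB hB1 q₀
  refine (congrArg (BallEquicontAt · q₀) ?_).mp hmain
  funext h q
  refine intervalIntegral.integral_congr fun ξ _ => ?_
  have h1 := S.a_ne_zero j (S.charPt j q.2 ξ)
  have h2 := S.a_ne_zero k (S.charPt j q.2 ξ)
  have h3 := he0 (q.1, S.charPt j q.2 ξ)
  simp only [E, z, z', transport, hbt]
  field_simp

/-- The `k`-th component of a bounded continuous function. -/
noncomputable def component (v : BCnR n) (k : Fin n) : ℝ →ᵇ ℝ :=
  BoundedContinuousFunction.ofNormedAddCommGroup (fun s => v s k)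
    ((continuous_apply k).comp v.continuous) ‖v‖
    fun s => (norm_le_pi_norm _ k).trans (v.norm_coe_le_norm s)

theorem norm_component_le (v : BCnR n) (k : Fin n) : ‖component v k‖ ≤ ‖v‖ :=
  BoundedContinuousFunction.norm_ofNormedAddCommGroup_le _ (norm_nonneg v) _

/-- `F B C` is compact: `(C v)_k` is transported from the entry point along the
`k`-characteristics. -/
theorem isCompactOperator_F_B_C (hb : S.Factorizes) (hvan : S.OffDiagonalVanishes) :
    IsCompactOperator (S.F * S.B * S.C : BCn n →L[ℝ] BCn n) := by
  refine S.isCompactOperator_F_B_comp hvan S.C fun j k hjk p₀ => ?_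
  have h := (S.ballEquicontAt_transport hb hjk (A := fun _ => (S.entry j : ℝ))
    (B := fun q => (q.2.1 : ℝ)) continuous_const (fun _ => (S.entry j).2) (by fun_prop)
    (fun q => q.2.1.2) (S.entry k, p₀)).comp_param
    (g := fun p : Strip => (S.entry k, p)) (by fun_prop)
  exact h.comp_bounded (fun v => component (S.R v) k) ‖S.R‖
    fun v => (norm_component_le _ k).trans (S.R.le_opNorm v)

/-- The density at `x = η` of the source term in `(F f)_k`. -/
noncomputable def source (f : BCn n) (k : Fin n) (η : unitInterval) : ℝ →ᵇ ℝ :=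
  BoundedContinuousFunction.ofNormedAddCommGroup (fun s => f (η, s) k / S.a k (η, s))
    (((continuous_component f k).comp (by fun_prop)).div ((S.a k).continuous.comp (by fun_prop))
      fun _ => S.a_ne_zero k _) (‖f‖ / S.exists_speed_bound.choose) fun s => by
    rw [norm_div]
    exact div_le_div₀ (norm_nonneg f) ((norm_le_pi_norm _ k).trans (f.norm_coe_le_norm _))
      S.exists_speed_bound.choose_spec.1 (S.exists_speed_bound.choose_spec.2 k _)

theorem source_apply (f : BCn n) (k : Fin n) (η : unitInterval) (s : ℝ) :
    S.source f k η s = f (η, s) k / S.a k (η, s) := rfl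

theorem norm_source_le (f : BCn n) (k : Fin n) (η : unitInterval) :
    ‖S.source f k η‖ ≤ S.exists_speed_bound.choose⁻¹ * ‖f‖ := by
  rw [inv_mul_eq_div]
  exact BoundedContinuousFunction.norm_ofNormedAddCommGroup_le _
    (div_nonneg (norm_nonneg f) S.exists_speed_bound.choose_spec.1.le) _

theorem F_apply_eq_transport (f : BCn n) (k : Fin n) (q : Strip) :
    S.F f q k =
      ∫ η in (S.entry k : ℝ)..(q.1 : ℝ), S.transport k (S.source f k (pr η)) (pr η) q := by
  refine intervalIntegral.integral_congr fun η _ => ?_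
  simp only [transport, source_apply, charPt, d, dCoef]
  rw [div_mul_eq_mul_div, mul_div_assoc]
  rfl

theorem continuous_transport_source (f : BCn n) (k : Fin n) :
    Continuous fun q : unitInterval × Strip => S.transport k (S.source f k q.1) q.1 q.2 := by
  have hpt : Continuous fun q : unitInterval × Strip => ((q.1, S.ω k q.1 q.2.1 q.2.2) : Strip) :=
    continuous_fst.prodMk (S.continuous_ω k)
  exact (S.continuous_c k).mul (((continuous_component f k).comp hpt).div
    ((S.a k).continuous.comp hpt) fun _ => S.a_ne_zero k _)

theorem continuous_transportIntegrand (f : BCn n) (j k : Fin n) :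
    Continuous fun r : (unitInterval × Strip) × ℝ =>
      S.d j (pr r.2) r.1.2.1 r.1.2.2 * (S.b j k (S.charPt j r.1.2 r.2) *
        S.transport k (S.source f k r.1.1) r.1.1 (S.charPt j r.1.2 r.2)) := by
  have h0 : Continuous fun r : (unitInterval × Strip) × ℝ => (r.1.2, r.2) := by fun_prop
  have h1 := (S.continuous_charPt j).comp h0
  exact ((S.continuous_d_pr j).comp h0).mul (((S.b j k).continuous.comp h1).mul
    ((S.continuous_transport_source f k).comp
      ((continuous_fst.comp continuous_fst).prodMk h1)))

theorem continuous_transportIntegral (f : BCn n) (j k : Fin n) {A B : unitInterval × Strip → ℝ}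
    (hA : Continuous A) (hB : Continuous B) :
    Continuous fun q => S.transportIntegral j k A B (S.source f k q.1) q := by
  have h2 : ∀ D : unitInterval × Strip → ℝ, Continuous D → Continuous fun q =>
      ∫ ξ in (0 : ℝ)..D q, S.d j (pr ξ) q.2.1 q.2.2 * (S.b j k (S.charPt j q.2 ξ) *
        S.transport k (S.source f k q.1) q.1 (S.charPt j q.2 ξ)) := fun D hD =>
    intervalIntegral.continuous_parametric_intervalIntegral_of_continuous
      (f := fun (q : unitInterval × Strip) ξ => S.d j (pr ξ) q.2.1 q.2.2 *
        (S.b j k (S.charPt j q.2 ξ) *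
          S.transport k (S.source f k q.1) q.1 (S.charPt j q.2 ξ)))
      (S.continuous_transportIntegrand f j k) hD
  refine ((h2 B hB).sub (h2 A hA)).congr fun q => ?_
  have hc := (S.continuous_transportIntegrand f j k).comp
    ((continuous_const (y := q)).prodMk (continuous_id (X := ℝ)))
  exact intervalIntegral.integral_interval_sub_left (μ := volume)
    (hc.intervalIntegrable _ _) (hc.intervalIntegrable _ _)

/-- `F B F` as an integral over `η` of transported functions, by exchange of the integrations. -/
theorem charIntegral_mul_F (f : BCn n) (j k : Fin n) (p : Strip) :
    S.charIntegral j (fun q => S.b j k q * S.F f q k) p =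
      (∫ η in (0 : ℝ)..1, S.transportIntegral j k (fun q => max (S.entry j : ℝ) q.1)
        (fun q => max (q.2.1 : ℝ) q.1) (S.source f k (pr η)) (pr η, p))
      - ∫ η in (0 : ℝ)..(S.entry k : ℝ), S.transportIntegral j k (fun _ => (S.entry j : ℝ))
        (fun q => (q.2.1 : ℝ)) (S.source f k (pr η)) (pr η, p) := by
  let φ : ℝ → ℝ → ℝ := fun ξ η => S.d j (pr ξ) p.1 p.2 * (S.b j k (S.charPt j p ξ) *
      S.transport k (S.source f k (pr η)) (pr η) (S.charPt j p ξ))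
  have hφc : Continuous (Function.uncurry φ) :=
    (S.continuous_transportIntegrand f j k).comp
      (((continuous_pr.comp continuous_snd).prodMk continuous_const).prodMk continuous_fst)
  have hswap := integral_integral_swap_of_mem_Icc hφc (b := (S.entry k : ℝ)) (S.entry j).2 p.1.2
  have h1 : S.charIntegral j (fun q => S.b j k q * S.F f q k) p =
      ∫ ξ in (S.entry j : ℝ)..(p.1 : ℝ), ∫ η in (S.entry k : ℝ)..ξ, φ ξ η := by
    refine intervalIntegral.integral_congr fun ξ hξ => ?_
    have hξ1 : ξ ∈ Icc (0 : ℝ) 1 := uIcc_subset_Icc (S.entry j).2 p.1.2 hξ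
    have h2 : ((S.charPt j p ξ).1 : ℝ) = ξ := by
      change ((pr ξ : unitInterval) : ℝ) = ξ
      rw [pr_of_mem hξ1]
    simp only [φ]
    rw [F_apply_eq_transport, h2, intervalIntegral.integral_const_mul,
      intervalIntegral.integral_const_mul]
  rw [h1, hswap]
  congr 1
  refine intervalIntegral.integral_congr fun η hη => ?_
  rw [uIcc_of_le zero_le_one] at hη
  have h3 : ((pr η : unitInterval) : ℝ) = η := by rw [pr_of_mem hη]
  simp only [transportIntegral, h3]
  rfl

/-- `F B F` is compact: after exchanging the two integrations, the inner integral is one of a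
transported function, where `h` and the starting point depend on the outer variable. -/
theorem isCompactOperator_F_B_F (hb : S.Factorizes) (hvan : S.OffDiagonalVanishes) :
    IsCompactOperator (S.F * S.B * S.F : BCn n →L[ℝ] BCn n) := by
  refine S.isCompactOperator_F_B_comp hvan S.F fun j k hjk p₀ => ?_
  simp only [charIntegral_mul_F]
  have hpr : ∀ p : Strip, Continuous fun η : ℝ => (pr η, p) := fun p =>
    continuous_pr.prodMk continuous_const
  refine BallEquicontAt.sub ?_ ?_
  · have hA : Continuous fun q : unitInterval × Strip => max (S.entry j : ℝ) q.1 := by fun_prop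
    have hB : Continuous fun q : unitInterval × Strip => max (q.2.1 : ℝ) q.1 := by fun_prop
    exact BallEquicontAt.integral_param (V := ℝ →ᵇ ℝ)
      (Ψ := fun h q => S.transportIntegral j k (fun q => max (S.entry j : ℝ) q.1)
        (fun q => max (q.2.1 : ℝ) q.1) h q)
      (fun η => S.ballEquicontAt_transport hb hjk hA
        (fun q => ⟨le_max_of_le_left (S.entry j).2.1, max_le (S.entry j).2.2 q.1.2.2⟩) hB
        (fun q => ⟨le_max_of_le_left q.2.1.2.1, max_le q.2.1.2.2 q.1.2.2⟩) (η, p₀))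
      (fun f η => S.source f k η) _ (fun f η => S.norm_source_le f k η) (by simp)
      fun f p => ((S.continuous_transportIntegral f j k hA hB).comp (hpr p)).intervalIntegrable _ _
  · have hB : Continuous fun q : unitInterval × Strip => (q.2.1 : ℝ) := by fun_prop
    exact BallEquicontAt.integral_param (V := ℝ →ᵇ ℝ)
      (Ψ := fun h q => S.transportIntegral j k (fun _ => (S.entry j : ℝ))
        (fun q => (q.2.1 : ℝ)) h q)
      (fun η => S.ballEquicontAt_transport hb hjk continuous_const (fun _ => (S.entry j).2) hB
        (fun q => q.2.1.2) (η, p₀))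
      (fun f η => S.source f k η) _ (fun f η => S.norm_source_le f k η) (S.entry k).2
      fun f p => ((S.continuous_transportIntegral f j k continuous_const hB).comp
        (hpr p)).intervalIntegrable _ _

end HyperbolicProblem

end HypStrip

/-! ### Reduction to an operator with compact square -/

/-- The kernels of `1 - A B` and `1 - B A` are isomorphic via `B` and `A`. -/
def SquareCompact.kerOneSubEquiv {X : Type*} [NormedAddCommGroup X] [NormedSpace ℝ X]
    (A B : X →L[ℝ] X) :
    LinearMap.ker ((1 - A * B : X →L[ℝ] X) : X →ₗ[ℝ] X) ≃ₗ[ℝ]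
      LinearMap.ker ((1 - B * A : X →L[ℝ] X) : X →ₗ[ℝ] X) where
  toFun u := ⟨B u, by
    have h : (u : X) - A (B u) = 0 := u.2
    change B u - B (A (B u)) = 0
    rw [← map_sub, h, map_zero]⟩
  invFun w := ⟨A w, by
    have h : (w : X) - B (A w) = 0 := w.2
    change A w - A (B (A w)) = 0
    rw [← map_sub, h, map_zero]⟩
  map_add' u v := Subtype.ext (map_add B _ _)
  map_smul' r u := Subtype.ext (map_smul B r _)
  left_inv u := by
    have h : (u : X) - A (B u) = 0 := u.2
    exact Subtype.ext (sub_eq_zero.1 h).symm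
  right_inv w := by
    have h : (w : X) - B (A w) = 0 := w.2
    exact Subtype.ext (sub_eq_zero.1 h).symm

namespace HypStrip

namespace HyperbolicProblem

variable {n : ℕ} (S : HyperbolicProblem n)

theorem isUnit_one_sub_C {ℓ : ℕ} (hC : ‖S.C ^ ℓ‖ < 1) : IsUnit (1 - S.C : BCn n →L[ℝ] BCn n) := by
  have h1 : IsUnit (1 - S.C ^ ℓ) := isUnit_one_sub_of_norm_lt_one hC
  rw [← mul_neg_geom_sum] at h1
  have hcomm : Commute (1 - S.C) (∑ i ∈ Finset.range ℓ, S.C ^ i) :=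
    Commute.sum_right _ _ _ fun i _ =>
      ((Commute.one_left _).sub_left (Commute.refl S.C)).pow_right i
  exact (hcomm.isUnit_mul_iff.1 h1).1

/-- If `W` inverts `1 - C`, solutions are the fixed points of `u ↦ W F (B u + f)`. -/
theorem isBCSolution_iff_of_inverse {W : BCn n →L[ℝ] BCn n} (h1 : (1 - S.C) * W = 1)
    (h2 : W * (1 - S.C) = 1) (f u : BCn n) :
    S.IsBCSolution f u ↔ u = (W * S.F) (S.B u + f) := by
  have h1' : ∀ v, W v - S.C (W v) = v := fun v => congrArg (fun T : BCn n →L[ℝ] BCn n => T v) h1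
  have h2' : ∀ v, W (v - S.C v) = v := fun v => congrArg (fun T : BCn n →L[ℝ] BCn n => T v) h2
  rw [isBCSolution_iff]
  change _ ↔ u = W (S.F (S.B u + f))
  constructor
  · intro h
    rw [← sub_eq_iff_eq_add'] at h
    rw [← h, h2']
  · intro h
    rw [← sub_eq_iff_eq_add', ← h1' (S.F (S.B u + f)), ← h]

/-- `(B W F)²` is compact for the inverse `W` of `1 - C`, because `W = 1 + C W` and both `F B F` and
`F B C` are compact. -/
theorem isCompactOperator_sq (hb : S.Factorizes) (hvan : S.OffDiagonalVanishes)
    {W : BCn n →L[ℝ] BCn n} (h1 : (1 - S.C) * W = 1) :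
    IsCompactOperator
      ((S.B * (W * S.F)) * (S.B * (W * S.F)) : BCn n →L[ℝ] BCn n) := by
  have hW : W = 1 + S.C * W := by
    rw [sub_mul, one_mul] at h1
    rw [← h1, sub_add_cancel]
  have e : (S.B * (W * S.F)) * (S.B * (W * S.F)) =
      (S.B * W) * (S.F * S.B * S.F + S.F * S.B * S.C * (W * S.F)) := by
    calc (S.B * (W * S.F)) * (S.B * (W * S.F)) = (S.B * W) * (S.F * S.B * W * S.F) := by
          simp only [mul_assoc]
      _ = (S.B * W) * (S.F * S.B * (1 + S.C * W) * S.F) := by rw [← hW]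
      _ = _ := by simp only [mul_add, add_mul, mul_one, mul_assoc]
  rw [e]
  exact ((S.isCompactOperator_F_B_F hb hvan).add
    ((S.isCompactOperator_F_B_C hb hvan).comp_clm (W * S.F))).clm_comp (S.B * W)

end HyperbolicProblem

end HypStrip

theorem theorem2p1 (n : ℕ) (S : HypStrip.HyperbolicProblem n)
    (hR : S.BoundaryRegular) (hb : S.Factorizes)
    (ℓ : ℕ) (hC : ‖S.C ^ ℓ‖ < 1) (hvan : S.OffDiagonalVanishes) :
    ∃ K G : Submodule ℝ (HypStrip.BCn n),
      (∀ u : HypStrip.BCn n, u ∈ K ↔ S.IsBCSolution 0 u) ∧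
      (∀ f : HypStrip.BCn n, f ∈ G ↔ ∃ u : HypStrip.BCn n, S.IsBCSolution f u) ∧
      FiniteDimensional ℝ K ∧
      IsClosed (G : Set (HypStrip.BCn n)) ∧
      FiniteDimensional ℝ (HypStrip.BCn n ⧸ G) ∧
      Module.finrank ℝ (HypStrip.BCn n ⧸ G) = Module.finrank ℝ K ∧
      (Module.finrank ℝ K = 0 → ∀ f : HypStrip.BCn n, ∃! u : HypStrip.BCn n,
        S.IsBCSolution f u) := by
  obtain ⟨T, hT⟩ := S.isUnit_one_sub_C hC
  have h1 : (1 - S.C) * (↑T⁻¹ : HypStrip.BCn n →L[ℝ] HypStrip.BCn n) = 1 := by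
    rw [← hT, T.mul_inv]
  have h2 : (↑T⁻¹ : HypStrip.BCn n →L[ℝ] HypStrip.BCn n) * (1 - S.C) = 1 := by
    rw [← hT, T.inv_mul]
  have hsol := S.isBCSolution_iff_of_inverse h1 h2
  have hcomp := S.isCompactOperator_sq hb hvan h1
  generalize (↑T⁻¹ : HypStrip.BCn n →L[ℝ] HypStrip.BCn n) * S.F = A at hsol hcomp
  obtain ⟨hfin, hclosed, ⟨φ⟩⟩ := SquareCompact.fredholm_index_zero hcomp
  let ψ := SquareCompact.kerOneSubEquiv A S.B
  have hK : ∀ u, u ∈ LinearMap.ker ((1 - A * S.B : HypStrip.BCn n →L[ℝ] HypStrip.BCn n) :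
      HypStrip.BCn n →ₗ[ℝ] HypStrip.BCn n) ↔ S.IsBCSolution 0 u := by
    intro u
    rw [hsol, add_zero]
    exact sub_eq_zero (a := u) (b := A (S.B u))
  have hG : ∀ f, f ∈ LinearMap.range ((1 - S.B * A : HypStrip.BCn n →L[ℝ] HypStrip.BCn n) :
      HypStrip.BCn n →ₗ[ℝ] HypStrip.BCn n) ↔ ∃ u, S.IsBCSolution f u := by
    intro f
    -- `w = B u + f` and `u = A w` translate `u = A (B u + f)` into `w - B (A w) = f`
    constructor
    · rintro ⟨w, rfl⟩
      refine ⟨A w, (hsol _ _).2 (congrArg A ?_)⟩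
      change w = S.B (A w) + (w - S.B (A w))
      abel
    · rintro ⟨u, hu⟩
      rw [hsol] at hu
      refine ⟨S.B u + f, ?_⟩
      change S.B u + f - S.B (A (S.B u + f)) = f
      rw [← hu]
      abel
  have hfinK := ψ.symm.finiteDimensional
  have hfinG := φ.finiteDimensional
  have hrank := (ψ.trans φ).finrank_eq.symm
  refine ⟨_, _, hK, hG, hfinK, hclosed, hfinG, hrank, fun h0 f => ?_⟩
  obtain ⟨u, hu⟩ : ∃ u, S.IsBCSolution f u := by
    rw [← hG]
    rw [h0] at hrank
    have := Module.finrank_zero_iff.1 hrank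
    exact (Submodule.Quotient.mk_eq_zero _).1 (Subsingleton.elim _ _)
  refine ⟨u, hu, fun v hv => ?_⟩
  have hbot := Submodule.finrank_eq_zero.1 h0
  have hmem : v - u ∈ LinearMap.ker ((1 - A * S.B : HypStrip.BCn n →L[ℝ] HypStrip.BCn n) :
      HypStrip.BCn n →ₗ[ℝ] HypStrip.BCn n) := by
    rw [hsol] at hu hv
    change v - u - A (S.B (v - u)) = 0
    nth_rewrite 1 [hv, hu]
    simp only [map_sub, map_add]
    abel
  rw [hbot, Submodule.mem_bot] at hmem
  exact sub_eq_zero.1 hmem
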